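/- Theorem (Existence of universal solution). Let $\mathbf{A}$ be a small category. A module $M:\mathbf{A}\rightharpoondown\mathbf{A}$ is a functor $M:\mathbf{A}^{\mathrm{op}}\times\mathbf{A}\to\mathbf{Set}$; an element $m\in M(b,a)$ is written as a crossed arrow $m: b\rightharpoondown a$, and for $f:a\to a'$ and $g:b'\to b$ in $\mathbf{A}$ we write $fm: b\rightharpoondown a'$ and $mg: b'\rightharpoondown a$ for the elements obtained by functoriality. For $X:\mathbf{A}\to\mathbf{Set}$ and $Y:\mathbf{A}^{\mathrm{op}}\to\mathbf{Set}$ put $Y\otimes X=\int^a Ya\times Xa$. Define the endofunctor $M\otimes-$ of $[\mathbf{A},\mathcal{E}]$, for $\mathcal{E}=\mathbf{Set}$ or $\mathcal{E}=\mathbf{Top}$ (the category of all topological spaces and continuous maps), by the coend $(M\otimes X)a=\int^b M(b,a)\times Xb$, where $M(b,a)\times Xb$ is the sum of $M(b,a)$ copies of $Xb$. A functor $X:\mathbf{A}\to\mathbf{Set}$ is nondegenerate if $-\otimes X:[\mathbf{A}^{\mathrm{op}},\mathbf{Set}]\to\mathbf{Set}$ preserves finite connected limits (limits over finite connected, in particular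 nonempty, categories). A functor $X:\mathbf{A}\to\mathbf{Top}$ is nondegenerate if its underlying functor $\mathbf{A}\to\mathbf{Set}$ is nondegenerate and $Xf$ is a closed map for each map $f$ of $\mathbf{A}$. The module $M$ is nondegenerate if $M(b,-)$ is nondegenerate for each $b\in\mathbf{A}$, and finite if for each $a\in\mathbf{A}$ there are only finitely many diagrams $b'\xrightarrow{f}b\overset{m}{\rightharpoondown}a$. A self-similarity system is a pair $(\mathbf{A},M)$ with $M$ finite and nondegenerate. For a self-similarity system $(\mathbf{A},M)$ and $\mathcal{E}\in\{\mathbf{Set},\mathbf{Top}\}$, an $M$-coalgebra in $\mathcal{E}$ is a nondegenerate functor $X:\mathbf{A}\to\mathcal{E}$ with a natural transformation $\xi:X\to M\otimes X$; a map $(X,\xi)\to(X',\xi')$ of $M$-coalgebras is a natural transformation $\alpha:X\to X'$ with $\xi'\alpha=(M\otimes\alpha)\xi$. A universal solution of $(\mathbf{A},M)$ in $\mathcal{E}$ is a terminal object of the category of $M$-coalgebras in $\mathcal{E}$. Call $(a_\bullet,m_\bullet)$ a sequence if $a_n\in\mathbf{A}$ for $n\ge 0$ and $m_n: a_n\rightharpoondown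 a_{n-1}$ for $n\ge 1$, and call a family of maps $f_n:a_n\to b_n$ ($n\ge 0$) in $\mathbf{A}$ a ladder $f_\bullet:(a_\bullet,m_\bullet)\to(b_\bullet,p_\bullet)$ between sequences if $p_nf_n=f_{n-1}m_n$ for all $n\ge 1$. Condition S on $(\mathbf{A},M)$ is the conjunction of: (S1) for all sequences $(a_\bullet,m_\bullet)$, $(a'_\bullet,m'_\bullet)$, $(b_\bullet,p_\bullet)$ and ladders $f_\bullet:(a_\bullet,m_\bullet)\to(b_\bullet,p_\bullet)$ and $f'_\bullet:(a'_\bullet,m'_\bullet)\to(b_\bullet,p_\bullet)$, there exist an object $c$ and maps $g:c\to a_0$, $g':c\to a'_0$ in $\mathbf{A}$ with $f_0g=f'_0g'$; (S2) for all sequences $(a_\bullet,m_\bullet)$, $(b_\bullet,p_\bullet)$ and ladders $f_\bullet,f'_\bullet:(a_\bullet,m_\bullet)\to(b_\bullet,p_\bullet)$, there exist an object $c$ and a map $g:c\to a_0$ in $\mathbf{A}$ with $f_0g=f'_0g$. Then for every self-similarity system $(\mathbf{A},M)$ the following are equivalent: 1. $(\mathbf{A},M)$ satisfies S; 2. $(\mathbf{A},M)$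 has a universal solution in $\mathbf{Top}$; 3. $(\mathbf{A},M)$ has a universal solution in $\mathbf{Set}$. -/

import Mathlib

open CategoryTheory CategoryTheory.Limits Opposite

universe u

namespace SelfSimilarity

/-! ### Modules and tensor products -/

/-- A module `B ⇸ A` between small categories: a functor `Bᵒᵖ × A ⥤ Set`, in curried form, so that
`M(b, a)` is `(M.obj (op b)).obj a`. -/
abbrev CatModule (B A : Type u) [SmallCategory B] [SmallCategory A] : Type (u + 1) :=
  Bᵒᵖ ⥤ A ⥤ Type u

section Module

variable {B A : Type u} [SmallCategory B] [SmallCategory A]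

/-- `M.Elt b a` is the set `M(b, a)`; its elements are the crossed arrows `b ⇸ a`. -/
abbrev CatModule.Elt (M : CatModule B A) (b : B) (a : A) : Type u := (M.obj (op b)).obj a

/-- The left action: `b ⇸ a` followed by `f : a ⟶ a'` is `f m : b ⇸ a'`. -/
def CatModule.lact (M : CatModule B A) {b : B} {a a' : A} (f : a ⟶ a') (m : M.Elt b a) :
    M.Elt b a' :=
  (M.obj (op b)).map f m

/-- The right action: `g : b' ⟶ b` followed by `b ⇸ a` is `m g : b' ⇸ a`. -/
def CatModule.ract (M : CatModule B A) {b' b : B} {a : A} (m : M.Elt b a) (g : b' ⟶ b) :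
    M.Elt b' a :=
  (M.map g.op).app a m

end Module

section Tensor

variable {A : Type u} [SmallCategory A]

/-- The sum `∑ a, Y a × X a`, written as the sum of copies of `X a` indexed by the pairs `(a, y)`
with `y ∈ Y a`. -/
abbrev PreTensor (Y : Aᵒᵖ ⥤ Type u) (X : A ⥤ Type u) : Type u :=
  Σ p : (Σ a : A, Y.obj (op a)), X.obj p.1

/-- The relation `(y g, x) ∼ (y, g x)`, which generates the equivalence relation defining the
tensor product. -/
inductive TensorRel (Y : Aᵒᵖ ⥤ Type u) (X : A ⥤ Type u) : PreTensor Y X → PreTensor Y X → Prop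
  | glue {a' a : A} (g : a' ⟶ a) (y : Y.obj (op a)) (x : X.obj a') :
      TensorRel Y X ⟨⟨a', Y.map g.op y⟩, x⟩ ⟨⟨a, y⟩, X.map g x⟩

/-- The tensor product `Y ⊗ X = ∫^a Y a × X a`, as the quotient of the sum `∑ a, Y a × X a` by the
equivalence relation generated by `TensorRel`. -/
def Tensor (Y : Aᵒᵖ ⥤ Type u) (X : A ⥤ Type u) : Type u := Quot (TensorRel Y X)

/-- The element `y ⊗ x`. -/
def Tensor.mk {Y : Aᵒᵖ ⥤ Type u} {X : A ⥤ Type u} {a : A} (y : Y.obj (op a)) (x : X.obj a) :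
    Tensor Y X :=
  Quot.mk _ ⟨⟨a, y⟩, x⟩

theorem Tensor.glue {Y : Aᵒᵖ ⥤ Type u} {X : A ⥤ Type u} {a' a : A} (g : a' ⟶ a)
    (y : Y.obj (op a)) (x : X.obj a') :
    (Tensor.mk (Y.map g.op y) x : Tensor Y X) = Tensor.mk y (X.map g x) :=
  Quot.sound (TensorRel.glue g y x)

/-- The tensor product is functorial in both variables: `y ⊗ x ↦ β y ⊗ α x`. -/
def Tensor.map {Y Y' : Aᵒᵖ ⥤ Type u} {X X' : A ⥤ Type u} (β : Y ⟶ Y') (α : X ⟶ X') :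
    Tensor Y X → Tensor Y' X' :=
  Quot.lift (fun t => Tensor.mk (β.app (op t.1.1) t.1.2) (α.app t.1.1 t.2)) (by
    rintro _ _ ⟨g, y, x⟩
    simp only [NatTrans.naturality_apply]
    exact Tensor.glue g _ _)

@[simp] theorem Tensor.map_mk {Y Y' : Aᵒᵖ ⥤ Type u} {X X' : A ⥤ Type u} (β : Y ⟶ Y')
    (α : X ⟶ X') {a : A} (y : Y.obj (op a)) (x : X.obj a) :
    Tensor.map β α (Tensor.mk y x) = Tensor.mk (β.app (op a) y) (α.app a x) := rfl

@[elab_as_elim]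
theorem Tensor.ind {Y : Aᵒᵖ ⥤ Type u} {X : A ⥤ Type u} {P : Tensor Y X → Prop}
    (h : ∀ (a : A) (y : Y.obj (op a)) (x : X.obj a), P (Tensor.mk y x)) (t : Tensor Y X) : P t :=
  Quot.ind (fun t => h t.1.1 t.1.2 t.2) t

theorem Tensor.map_id {Y : Aᵒᵖ ⥤ Type u} {X : A ⥤ Type u} (t : Tensor Y X) :
    Tensor.map (𝟙 Y) (𝟙 X) t = t := by
  induction t using Tensor.ind with
  | h a y x => simp

theorem Tensor.map_comp {Y Y' Y'' : Aᵒᵖ ⥤ Type u} {X X' X'' : A ⥤ Type u} (β : Y ⟶ Y')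
    (β' : Y' ⟶ Y'') (α : X ⟶ X') (α' : X' ⟶ X'') (t : Tensor Y X) :
    Tensor.map (β ≫ β') (α ≫ α') t = Tensor.map β' α' (Tensor.map β α t) := by
  induction t using Tensor.ind with
  | h a y x => simp

/-- The functor `- ⊗ X : [Aᵒᵖ, Set] ⥤ Set`. -/
def tensorRight (X : A ⥤ Type u) : (Aᵒᵖ ⥤ Type u) ⥤ Type u where
  obj Y := Tensor Y X
  map β := ↾(Tensor.map β (𝟙 X))
  map_id Y := by ext t; exact Tensor.map_id t
  map_comp β β' := by
    ext t
    simpa using Tensor.map_comp β β' (𝟙 X) (𝟙 X) t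

end Tensor

/-! ### Nondegeneracy and self-similarity systems -/

section Nondegenerate

variable {A : Type u} [SmallCategory A]

/-- A functor `X : A ⥤ Set` is nondegenerate (componentwise flat) if `- ⊗ X : [Aᵒᵖ, Set] ⥤ Set`
preserves finite connected limits. -/
def NondegenerateSet (X : A ⥤ Type u) : Prop :=
  ∀ (J : Type) [SmallCategory J] [FinCategory J] [IsConnected J],
    PreservesLimitsOfShape J (tensorRight X)

/-- A functor `X : A ⥤ Top` is nondegenerate if its underlying functor to sets is, and each map
`X f` is closed. -/
def NondegenerateTop (X : A ⥤ TopCat.{u}) : Prop :=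
  NondegenerateSet (X ⋙ forget TopCat.{u}) ∧
    ∀ ⦃a a' : A⦄ (f : a ⟶ a'), IsClosedMap (X.map f)

/-- A module `M : B ⇸ A` is nondegenerate if each functor `M(b, -)` is. -/
def CatModule.Nondegenerate {B : Type u} [SmallCategory B] (M : CatModule B A) : Prop :=
  ∀ b : B, NondegenerateSet (M.obj (op b))

/-- A module `M : A ⇸ A` is finite if for each `a` the category of elements of `M(-, a)` is finite,
that is, there are only finitely many diagrams `b' ⟶ b ⇸ a` (the arrows of that category). -/
def CatModule.IsFinite (M : CatModule A A) : Prop :=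
  ∀ a : A, Finite (Σ b' : A, Σ b : A, (b' ⟶ b) × M.Elt b a)

/-- `(A, M)` is a self-similarity system: `M : A ⇸ A` is finite and nondegenerate. -/
structure IsSelfSimilaritySystem (M : CatModule A A) : Prop where
  finite : M.IsFinite
  nondegenerate : M.Nondegenerate

end Nondegenerate

/-! ### Coalgebras and universal solutions -/

section Coalgebra

variable {A : Type u} [SmallCategory A]

/-- The endofunctor `M ⊗ -` of `[A, Set]`, where `(M ⊗ X) a = ∫^b M(b, a) × X b`. -/
def tensorSet (M : CatModule A A) : (A ⥤ Type u) ⥤ (A ⥤ Type u) where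
  obj X :=
    { obj := fun a => Tensor (M.flip.obj a) X
      map := fun f => ↾(Tensor.map (M.flip.map f) (𝟙 X))
      map_id := fun a => by
        ext t
        simpa using Tensor.map_id t
      map_comp := fun f f' => by
        ext t
        simpa using Tensor.map_comp (M.flip.map f) (M.flip.map f') (𝟙 X) (𝟙 X) t }
  map α :=
    { app := fun a => ↾(Tensor.map (𝟙 (M.flip.obj a)) α)
      naturality := fun a a' f => by
        ext t
        induction t using Tensor.ind with
        | h a y x => simp }
  map_id X := by
    ext a t
    exact Tensor.map_id t
  map_comp α α' := by
    ext a t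
    simpa using Tensor.map_comp (𝟙 _) (𝟙 _) α α' t

/-- For `X : A ⥤ Top`, the coend `Y ⊗ X = ∫^a Y a × X a` in `Top`: the set `Y ⊗ X` with the
quotient topology from the topological sum `∑ a, Y a × X a` of copies of the spaces `X a`. -/
instance tensorTopology (Y : Aᵒᵖ ⥤ Type u) (X : A ⥤ TopCat.{u}) :
    TopologicalSpace (Tensor Y (X ⋙ forget TopCat.{u})) :=
  TopologicalSpace.coinduced
    (fun t : (Σ p : (Σ a : A, Y.obj (op a)), X.obj p.1) => Tensor.mk t.1.2 t.2)
    inferInstance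

theorem Tensor.continuous_map {Y Y' : Aᵒᵖ ⥤ Type u} {X X' : A ⥤ TopCat.{u}} (β : Y ⟶ Y')
    (α : X ⟶ X') :
    Continuous (Tensor.map β (Functor.whiskerRight α (forget TopCat.{u}))) := by
  refine continuous_coinduced_dom.2 (continuous_sigma fun p => ?_)
  have h : Continuous fun t : (Σ p : (Σ a : A, Y'.obj (op a)), X'.obj p.1) =>
      (Tensor.mk t.1.2 t.2 : Tensor Y' (X' ⋙ forget TopCat.{u})) := continuous_coinduced_rng
  exact h.comp ((continuous_sigmaMk (σ := fun p : (Σ a : A, Y'.obj (op a)) => X'.obj p.1)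
    (i := ⟨p.1, β.app (op p.1) p.2⟩)).comp (α.app p.1).hom.continuous)

/-- The endofunctor `M ⊗ -` of `[A, Top]`, where `(M ⊗ X) a = ∫^b M(b, a) × X b`. -/
def tensorTop (M : CatModule A A) : (A ⥤ TopCat.{u}) ⥤ (A ⥤ TopCat.{u}) where
  obj X :=
    { obj := fun a => TopCat.of (Tensor (M.flip.obj a) (X ⋙ forget TopCat.{u}))
      map := fun f => TopCat.ofHom ⟨_, Tensor.continuous_map (M.flip.map f) (𝟙 X)⟩
      map_id := fun a => by
        ext t
        induction t using Tensor.ind with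
        | h b y x => simp
      map_comp := fun f f' => by
        ext t
        induction t using Tensor.ind with
        | h b y x => simp }
  map α :=
    { app := fun a => TopCat.ofHom ⟨_, Tensor.continuous_map (𝟙 (M.flip.obj a)) α⟩
      naturality := fun a a' f => by
        ext t
        induction t using Tensor.ind with
        | h b y x => simp }
  map_id X := by
    ext a t
    induction t using Tensor.ind with
    | h b y x => simp
  map_comp α α' := by
    ext a t
    induction t using Tensor.ind with
    | h b y x => simp

/-- The category of `M`-coalgebras in `Set`: coalgebras for `M ⊗ -` whose carrier is nondegenerate.
Since the nondegenerate functors form a full subcategory of `[A, Set]`, an object is a nondegenerate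
`X` with a natural transformation `X ⟶ M ⊗ X`, and a map is a natural transformation commuting
with the structure maps. -/
abbrev CoalgSet (M : CatModule A A) : Type (u + 1) :=
  ObjectProperty.FullSubcategory
    (fun X : Endofunctor.Coalgebra (tensorSet M) => NondegenerateSet X.V)

/-- The category of `M`-coalgebras in `Top`: coalgebras for `M ⊗ -` whose carrier is nondegenerate
(the nondegenerate functors form a full subcategory of `[A, Top]`). -/
abbrev CoalgTop (M : CatModule A A) : Type (u + 1) :=
  ObjectProperty.FullSubcategory
    (fun X : Endofunctor.Coalgebra (tensorTop M) => NondegenerateTop X.V)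

/-- A universal solution in `Set` is a terminal object of the category of `M`-coalgebras in
`Set`. -/
def HasUniversalSolutionSet (M : CatModule A A) : Prop :=
  ∃ J : CoalgSet M, Nonempty (IsTerminal J)

/-- A universal solution in `Top` is a terminal object of the category of `M`-coalgebras in
`Top`. -/
def HasUniversalSolutionTop (M : CatModule A A) : Prop :=
  ∃ J : CoalgTop M, Nonempty (IsTerminal J)

end Coalgebra

/-! ### The solvability condition -/

section Solvability

variable {A : Type u} [SmallCategory A]

/-- An infinite sequence `⋯ ⇸ a₂ ⇸ a₁ ⇸ a₀` of module elements; `elt n : aₙ₊₁ ⇸ aₙ`. -/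
structure InfSeq (M : CatModule A A) where
  obj : ℕ → A
  elt : ∀ n, M.Elt (obj (n + 1)) (obj n)

/-- A ladder from `(a, m)` to `(b, p)`: maps `fₙ : aₙ ⟶ bₙ` such that each square commutes, that is,
`pₙ₊₁ fₙ₊₁ = fₙ mₙ₊₁` for all `n`. -/
structure Ladder {M : CatModule A A} (s t : InfSeq M) where
  map : ∀ n, s.obj n ⟶ t.obj n
  comm : ∀ n, M.ract (t.elt n) (map (n + 1)) = M.lact (map n) (s.elt n)

/-- Condition S1: for ladders `f : (a, m) ⟶ (b, p)` and `f' : (a', m') ⟶ (b, p)`, the cospan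
`f₀, f'₀` can be completed to a commutative square. -/
def ConditionS1 (M : CatModule A A) : Prop :=
  ∀ (s s' t : InfSeq M) (f : Ladder s t) (f' : Ladder s' t),
    ∃ (c : A) (g : c ⟶ s.obj 0) (g' : c ⟶ s'.obj 0), g ≫ f.map 0 = g' ≫ f'.map 0

/-- Condition S2: for parallel ladders `f, f' : (a, m) ⟶ (b, p)`, the parallel pair `f₀, f'₀` can be
extended to a fork. -/
def ConditionS2 (M : CatModule A A) : Prop :=
  ∀ (s t : InfSeq M) (f f' : Ladder s t),
    ∃ (c : A) (g : c ⟶ s.obj 0), g ≫ f.map 0 = g ≫ f'.map 0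

/-- The solvability condition S. -/
def ConditionS (M : CatModule A A) : Prop := ConditionS1 M ∧ ConditionS2 M

end Solvability

end SelfSimilarity

/-!
Write a sequence for `⋯ ⇸ a₂ ⇸ a₁ ⇸ a₀` and a ladder for a map of sequences.

From topological spaces to sets, the forgetful functor on coalgebras has a left adjoint (discrete
topologies), so it preserves terminal objects. From sets to condition S: a sequence generates a
nondegenerate coalgebra, a sum of representables, and a ladder induces a map of such coalgebras in
the opposite direction. Hence a universal solution contains one element for each sequence, compatibly
with ladders, and the elementwise form of nondegeneracy (`ComponentwiseFlat`) of the solution turns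
pairs of ladders into the squares and forks that S requires
(`HasUniversalSolutionSet.conditionS`).

The main work is to construct the universal solution in topological spaces from condition S. Its
underlying functor `sol M` is the colimit of the representables `A(a₀, -)` over all sequences.

* Condition S only speaks of stage zero, but applied to all stages, together with nondegeneracy and
  finiteness of `M` and König's lemma, it completes squares and forks of ladders by ladders
  (`ConditionS1.exists_ladder_square`, `ConditionS2.exists_ladder_fork`). So the colimit defining
  `sol M` is componentwise filtered, and `sol M` is nondegenerate (`sol.componentwiseFlat`).
* In a nondegenerate coalgebra every element has a resolution along some sequence, and any two
  resolutions have a common refinement (`Resolution.exists_ladders`). Sending an element to the class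
  of its resolutions is a coalgebra map to `sol M` (`toSol_comm`). It is the only one, because coalgebra
  maps preserve resolutions and in `sol M` an element is the class of each of its resolutions
  (`Resolution.elt_zero_eq`).
* The topology on `sol M` is the quotient topology from the profinite space of sequences. Continuity
  of the actions of maps and of the structure map is immediate. That the maps act by closed maps
  (`sol.isClosedMap_map`) and that the canonical map from a topological coalgebra is continuous
  (`continuous_toSol`) are compactness arguments, made with König's lemma in
  `sol.exists_map_eq_mk` and `Resolution.mk_mem_of_mem_meets`.
-/

namespace SelfSimilarity

/-! ### Nondegenerate functors, elementwise -/

section Elementwise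

variable {A : Type u} [SmallCategory A]

/-- The elementwise form of nondegeneracy of `X : A ⥤ Set`: every connected component of the
category of elements of `X` is cofiltered. Unlike cofilteredness of the whole category of elements,
this asks for no common refinement of unrelated elements, and `X` may be empty. -/
structure ComponentwiseFlat (X : A ⥤ Type u) : Prop where
  square : ∀ {a a' b : A} (f : a ⟶ b) (f' : a' ⟶ b) (x : X.obj a) (x' : X.obj a'),
    X.map f x = X.map f' x' → ∃ (c : A) (g : c ⟶ a) (g' : c ⟶ a') (z : X.obj c),
      g ≫ f = g' ≫ f' ∧ X.map g z = x ∧ X.map g' z = x'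
  fork : ∀ {a b : A} (f f' : a ⟶ b) (x : X.obj a), X.map f x = X.map f' x →
    ∃ (c : A) (g : c ⟶ a) (z : X.obj c), g ≫ f = g ≫ f' ∧ X.map g z = x

/-- Evaluation `A(-, a) ⊗ X → X a`, the co-Yoneda map `h ⊗ x ↦ h x`. -/
def Tensor.eval (X : A ⥤ Type u) (a : A) : Tensor (yoneda.obj a) X → X.obj a :=
  Quot.lift (fun t => X.map (show t.1.1 ⟶ a from t.1.2) t.2) (by
    rintro _ _ ⟨g, y, x⟩
    exact X.map_comp_apply g y x)

theorem Tensor.eval_mk (X : A ⥤ Type u) {a b : A} (h : b ⟶ a) (x : X.obj b) :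
    Tensor.eval X a (Tensor.mk (Y := yoneda.obj a) h x) = X.map h x := rfl

theorem Tensor.mk_yoneda (X : A ⥤ Type u) {a b : A} (h : b ⟶ a) (x : X.obj b) :
    (Tensor.mk (Y := yoneda.obj a) h x) = Tensor.mk (Y := yoneda.obj a) (𝟙 a) (X.map h x) := by
  have := Tensor.glue (Y := yoneda.obj a) h (𝟙 a) x
  simpa using this

/-- Preservation of pullbacks and equalizers of representables already gives the elementwise
conditions. -/
theorem NondegenerateSet.componentwiseFlat {X : A ⥤ Type u} (hX : NondegenerateSet X) :
    ComponentwiseFlat X where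
  square {a a' b} f f' x x' h := by
    have := hX WalkingCospan
    have sq := (IsPullback.of_hasPullback (yoneda.map f) (yoneda.map f')).map (tensorRight X)
    obtain ⟨p, hp, hp'⟩ := Types.exists_of_isPullback sq
      (Tensor.mk (Y := yoneda.obj a) (𝟙 a) x) (Tensor.mk (Y := yoneda.obj a') (𝟙 a') x') (by
        change Tensor.mk (Y := yoneda.obj b) (𝟙 a ≫ f) x =
          Tensor.mk (Y := yoneda.obj b) (𝟙 a' ≫ f') x'
        rw [Category.id_comp, Category.id_comp, Tensor.mk_yoneda X f, Tensor.mk_yoneda X f', h])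
    induction p using Tensor.ind with
    | h c y z =>
      refine ⟨c, (pullback.fst (yoneda.map f) (yoneda.map f')).app (op c) y,
        (pullback.snd (yoneda.map f) (yoneda.map f')).app (op c) y, z, ?_, ?_, ?_⟩
      · have := congrArg (fun k => k.app (op c) y)
          (pullback.condition (f := yoneda.map f) (g := yoneda.map f'))
        exact this
      · have := congrArg (Tensor.eval X a) hp
        exact this.trans (by simp [Tensor.eval_mk])
      · have := congrArg (Tensor.eval X a') hp'
        exact this.trans (by simp [Tensor.eval_mk])
  fork {a b} f f' x h := by
    have := hX WalkingParallelPair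
    have lim := isLimitForkMapOfIsLimit (tensorRight X)
      (equalizer.condition (yoneda.map f) (yoneda.map f'))
      (equalizerIsEqualizer (yoneda.map f) (yoneda.map f'))
    obtain ⟨p, hp, -⟩ := (Types.type_equalizer_iff_unique _ _).1 ⟨lim⟩
      (Tensor.mk (Y := yoneda.obj a) (𝟙 a) x) (by
        change Tensor.mk (Y := yoneda.obj b) (𝟙 a ≫ f) x =
          Tensor.mk (Y := yoneda.obj b) (𝟙 a ≫ f') x
        rw [Category.id_comp, Category.id_comp, Tensor.mk_yoneda X f, Tensor.mk_yoneda X f', h])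
    induction p using Tensor.ind with
    | h c y z =>
      refine ⟨c, (equalizer.ι (yoneda.map f) (yoneda.map f')).app (op c) y, z, ?_, ?_⟩
      · have := congrArg (fun k => k.app (op c) y)
          (equalizer.condition (yoneda.map f) (yoneda.map f'))
        exact this
      · have := congrArg (Tensor.eval X a) hp
        exact this.trans (by simp [Tensor.eval_mk])

/-- Over a componentwise flat functor, two elements of a tensor product are equal exactly when a
single span identifies them: zigzags compose because squares can be completed. -/
theorem ComponentwiseFlat.mk_eq_mk_iff {X : A ⥤ Type u} (hX : ComponentwiseFlat X)
    {Y : Aᵒᵖ ⥤ Type u} {a a' : A} {y : Y.obj (op a)} {x : X.obj a} {y' : Y.obj (op a')}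
    {x' : X.obj a'} :
    (Tensor.mk y x : Tensor Y X) = Tensor.mk y' x' ↔
      ∃ (c : A) (g : c ⟶ a) (g' : c ⟶ a') (z : X.obj c),
        Y.map g.op y = Y.map g'.op y' ∧ X.map g z = x ∧ X.map g' z = x' := by
  constructor
  · intro h
    have key : ∀ p q : PreTensor Y X, Relation.EqvGen (TensorRel Y X) p q →
        ∃ (c : A) (g : c ⟶ p.1.1) (g' : c ⟶ q.1.1) (z : X.obj c),
          Y.map g.op p.1.2 = Y.map g'.op q.1.2 ∧ X.map g z = p.2 ∧ X.map g' z = q.2 := by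
      intro p q hpq
      induction hpq with
      | rel p q h =>
        obtain ⟨g, y, x⟩ := h
        exact ⟨_, 𝟙 _, g, x, by simp, by simp, rfl⟩
      | refl p => exact ⟨_, 𝟙 _, 𝟙 _, p.2, rfl, by simp, by simp⟩
      | symm p q _ ih =>
        obtain ⟨c, g, g', z, h₁, h₂, h₃⟩ := ih
        exact ⟨c, g', g, z, h₁.symm, h₃, h₂⟩
      | trans p q r _ _ ih ih' =>
        obtain ⟨c, g, g', z, h₁, h₂, h₃⟩ := ih
        obtain ⟨d, k, k', w, h₁', h₂', h₃'⟩ := ih'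
        obtain ⟨e, l, l', v, hl, hv, hv'⟩ := hX.square g' k z w (h₃.trans h₂'.symm)
        refine ⟨e, l ≫ g, l' ≫ k', v, ?_, by simp [hv, h₂], by simp [hv', h₃']⟩
        calc Y.map (l ≫ g).op p.1.2 = Y.map (l ≫ g').op q.1.2 := by simp [h₁]
          _ = Y.map (l' ≫ k').op r.1.2 := by rw [hl]; simp [h₁']
    exact key _ _ (Quot.eqvGen_exact h)
  · rintro ⟨c, g, g', z, h, rfl, rfl⟩
    rw [← Tensor.glue, ← Tensor.glue, h]

/-- The case of a common second factor, where the span can be taken to have equal legs. -/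
theorem ComponentwiseFlat.exists_map_eq_of_mk_eq {X : A ⥤ Type u} (hX : ComponentwiseFlat X)
    {Y : Aᵒᵖ ⥤ Type u} {a : A} {y y' : Y.obj (op a)} {x : X.obj a}
    (h : (Tensor.mk y x : Tensor Y X) = Tensor.mk y' x) :
    ∃ (c : A) (g : c ⟶ a) (z : X.obj c), X.map g z = x ∧ Y.map g.op y = Y.map g.op y' := by
  obtain ⟨c, g, g', z, h, hz, hz'⟩ := hX.mk_eq_mk_iff.1 h
  obtain ⟨d, k, w, hk, rfl⟩ := hX.fork g g' z (hz.trans hz'.symm)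
  refine ⟨d, k ≫ g, w, by simp [hz], ?_⟩
  calc Y.map (k ≫ g).op y = Y.map (k ≫ g').op y' := by simp [h]
    _ = Y.map (k ≫ g).op y' := by rw [hk]

/-- Finitely many conditions on refinements `(d, w) ⟶ (c, z)` of an element, each stable under
further refinement and each attainable, can be attained simultaneously. -/
theorem ComponentwiseFlat.exists_common_refinement {X : A ⥤ Type u} (hX : ComponentwiseFlat X)
    {ι : Type*} [Finite ι] {c : A} (z : X.obj c)
    (P : ι → ∀ d : A, (d ⟶ c) → X.obj d → Prop)
    (stable : ∀ i d (g : d ⟶ c) (w : X.obj d) e (k : e ⟶ d) (v : X.obj e),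
      P i d g w → X.map k v = w → P i e (k ≫ g) v)
    (attain : ∀ i, ∃ d g w, X.map g w = z ∧ P i d g w) :
    ∃ d g w, X.map g w = z ∧ ∀ i, P i d g w := by
  classical
  have := Fintype.ofFinite ι
  suffices H : ∀ s : Finset ι, ∃ d g w, X.map g w = z ∧ ∀ i ∈ s, P i d g w by
    obtain ⟨d, g, w, h, h'⟩ := H Finset.univ
    exact ⟨d, g, w, h, fun i => h' i (Finset.mem_univ i)⟩
  intro s
  induction s using Finset.induction_on with
  | empty => exact ⟨c, 𝟙 c, z, by simp, by simp⟩
  | insert i s _ ih =>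
    obtain ⟨d, g, w, h, hs⟩ := ih
    obtain ⟨d', g', w', h', hi⟩ := attain i
    obtain ⟨e, k, k', v, hk, hv, hv'⟩ := hX.square g g' w w' (h.trans h'.symm)
    refine ⟨e, k ≫ g, v, by simp [hv, h], fun j hj => ?_⟩
    rcases Finset.mem_insert.1 hj with rfl | hj
    · rw [hk]
      exact stable _ _ _ _ _ _ _ hi hv'
    · exact stable _ _ _ _ _ _ _ (hs j hj) hv

/-- Elements related by a span form an equivalence class, so the first factors of a compatible
family of tensors over a connected diagram all lie in one component of the category of elements. -/
theorem ComponentwiseFlat.exists_span_of_section {X : A ⥤ Type u} (hX : ComponentwiseFlat X)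
    {J : Type} [SmallCategory J] [IsConnected J] (K : J ⥤ Aᵒᵖ ⥤ Type u) {a : J → A}
    (y : ∀ j, (K.obj j).obj (op (a j))) (x : ∀ j, X.obj (a j))
    (hs : ∀ {j j'} (u : j ⟶ j'), (Tensor.mk ((K.map u).app _ (y j)) (x j) : Tensor (K.obj j') X) =
      Tensor.mk (y j') (x j')) (i j : J) :
    ∃ (d : A) (g : d ⟶ a i) (h : d ⟶ a j) (w : X.obj d), X.map g w = x i ∧ X.map h w = x j := by
  have trans : ∀ {j j' j'' : J},
      (∃ d, ∃ (g : d ⟶ a j) (h : d ⟶ a j'), ∃ w : X.obj d, X.map g w = x j ∧ X.map h w = x j') →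
      (∃ d, ∃ (g : d ⟶ a j') (h : d ⟶ a j''), ∃ w : X.obj d,
        X.map g w = x j' ∧ X.map h w = x j'') →
      ∃ d, ∃ (g : d ⟶ a j) (h : d ⟶ a j''), ∃ w : X.obj d, X.map g w = x j ∧ X.map h w = x j'' := by
    rintro j j' j'' ⟨d, g, h, w, e₁, e₂⟩ ⟨d', g', h', w', e₁', e₂'⟩
    obtain ⟨e, k, k', v, -, hv, hv'⟩ := hX.square h g' w w' (e₂.trans e₁'.symm)
    exact ⟨e, k ≫ g, k' ≫ h', v, by simp [hv, e₁], by simp [hv', e₂']⟩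
  have step : ∀ {j j' : J} (u : j ⟶ j'), ∃ d, ∃ (g : d ⟶ a j) (h : d ⟶ a j'), ∃ w : X.obj d,
      X.map g w = x j ∧ X.map h w = x j' := by
    intro j j' u
    obtain ⟨d, g, h, w, -, hg, hh⟩ := hX.mk_eq_mk_iff.1 (hs u)
    exact ⟨d, g, h, w, hg, hh⟩
  have symm : ∀ {j j' : J},
      (∃ d, ∃ (g : d ⟶ a j) (h : d ⟶ a j'), ∃ w : X.obj d, X.map g w = x j ∧ X.map h w = x j') →
      ∃ d, ∃ (g : d ⟶ a j') (h : d ⟶ a j), ∃ w : X.obj d, X.map g w = x j' ∧ X.map h w = x j := by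
    rintro j j' ⟨d, g, h, w, e₁, e₂⟩
    exact ⟨d, h, g, w, e₂, e₁⟩
  exact induct_on_objects {j | ∃ d, ∃ (g : d ⟶ a i) (h : d ⟶ a j), ∃ w : X.obj d,
      X.map g w = x i ∧ X.map h w = x j} (j₀ := i) ⟨a i, 𝟙 _, 𝟙 _, x i, by simp, by simp⟩
    (fun u => ⟨fun h => trans h (step u), fun h => trans h (symm (step u))⟩) j

/-- The elementwise conditions give preservation of all finite connected limits: connectedness
brings the factors of a compatible family into one component of the category of elements of `X`,
where finitely many refinements can be made at once. -/
theorem ComponentwiseFlat.nondegenerateSet {X : A ⥤ Type u} (hX : ComponentwiseFlat X) :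
    NondegenerateSet X := by
  intro J _ _ _
  refine ⟨fun {K} => ⟨fun {c} hc => (Types.isLimit_iff _).2 fun s hs => ?_⟩⟩
  have hc' : ∀ b : A, Nonempty (IsLimit (((evaluation _ _).obj (op b)).mapCone c)) :=
    fun b => ⟨isLimitOfPreserves ((evaluation Aᵒᵖ (Type u)).obj (op b)) hc⟩
  simp only [Types.isLimit_iff] at hc'
  obtain ⟨i⟩ : Nonempty J := inferInstance
  refine existsUnique_of_exists_of_unique ?_ ?_
  · have rep : ∀ j, ∃ (a : A) (y : (K.obj j).obj (op a)) (x : X.obj a), s j = Tensor.mk y x := by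
      intro j
      generalize s j = t
      induction t using Tensor.ind with
      | h a y x => exact ⟨a, y, x, rfl⟩
    choose a y x hyx using rep
    have compat : ∀ {j j'} (u : j ⟶ j'),
        (Tensor.mk ((K.map u).app _ (y j)) (x j) : Tensor (K.obj j') X) =
          Tensor.mk (y j') (x j') := by
      intro j j' u
      have := hs u
      rw [hyx, hyx] at this
      exact this
    obtain ⟨d, g, z, -, hd⟩ := hX.exists_common_refinement (ι := J) (x i)
      (fun j d _ w => ∃ h : d ⟶ a j, X.map h w = x j)
      (by
        rintro j d g w e k v ⟨h, hh⟩ hk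
        exact ⟨k ≫ h, by simp [hk, hh]⟩)
      (fun j => by
        obtain ⟨d, g, h, w, e, e'⟩ := hX.exists_span_of_section K y x compat i j
        exact ⟨d, g, w, e, h, e'⟩)
    choose h hh using hd
    have hs' : ∀ j, s j = (Tensor.mk ((K.obj j).map (h j).op (y j)) z : Tensor (K.obj j) X) := by
      intro j
      rw [hyx, Tensor.glue, hh]
    obtain ⟨e, k, w, hk, he⟩ := hX.exists_common_refinement (ι := Σ j j' : J, j ⟶ j') z
      (fun u e k _ => (K.obj u.2.1).map k.op ((K.map u.2.2).app _
          ((K.obj u.1).map (h u.1).op (y u.1))) =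
        (K.obj u.2.1).map k.op ((K.obj u.2.1).map (h u.2.1).op (y u.2.1)))
      (by
        intro u d g w e k v hu _
        simp only [op_comp, Functor.map_comp_apply]
        exact congrArg _ hu)
      (by
        rintro ⟨j, j', u⟩
        obtain ⟨e, k, w, hk, he⟩ := hX.exists_map_eq_of_mk_eq (X := X) (Y := K.obj j')
          (y := (K.map u).app _ ((K.obj j).map (h j).op (y j)))
          (y' := (K.obj j').map (h j').op (y j')) (x := z) (by
            have := hs u
            rw [hs', hs'] at this
            exact this)
        exact ⟨e, k, w, hk, he⟩)
    obtain ⟨l, hl, -⟩ := hc' e (fun j => (K.obj j).map k.op ((K.obj j).map (h j).op (y j))) (by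
      intro j j' u
      refine Eq.trans ?_ (he ⟨j, j', u⟩)
      exact NatTrans.naturality_apply (K.map u) k.op _)
    refine ⟨(Tensor.mk l w : Tensor c.pt X), fun j => ?_⟩
    rw [hs', ← hk, ← Tensor.glue, ← hl j]
    change Tensor.mk _ ((𝟙 X : X ⟶ X).app e w) = _
    simp
  · intro t t' ht ht'
    induction t using Tensor.ind with
    | h a l x =>
    induction t' using Tensor.ind with
    | h a' l' x' =>
    have heq : ∀ j, (Tensor.mk ((c.π.app j).app _ l) x : Tensor (K.obj j) X) =
        Tensor.mk ((c.π.app j).app _ l') x' := fun j => (ht j).trans (ht' j).symm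
    obtain ⟨b, g, g', z, -, rfl, rfl⟩ := hX.mk_eq_mk_iff.1 (heq i)
    simp only [← Tensor.glue, ← NatTrans.naturality_apply] at heq
    obtain ⟨e, k, w, hk, he⟩ := hX.exists_common_refinement (ι := J) z
      (fun j e k _ => (K.obj j).map k.op ((c.π.app j).app _ (c.pt.map g.op l)) =
        (K.obj j).map k.op ((c.π.app j).app _ (c.pt.map g'.op l')))
      (by
        intro u d g w e k v hu _
        simp only [op_comp, Functor.map_comp_apply]
        exact congrArg _ hu)
      (fun j => by
        obtain ⟨e, k, w, hk, he⟩ := hX.exists_map_eq_of_mk_eq (heq j)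
        exact ⟨e, k, w, hk, he⟩)
    rw [← Tensor.glue, ← Tensor.glue, ← hk, ← Tensor.glue, ← Tensor.glue]
    congr 1
    refine (hc' e (fun j => (c.π.app j).app _ (c.pt.map k.op (c.pt.map g.op l))) ?_).unique
      (fun j => rfl) (fun j => ?_)
    · intro j j' u
      have := congrArg (fun f => f.app (op e) (c.pt.map k.op (c.pt.map g.op l))) (c.w u)
      exact this
    · simp only [← NatTrans.naturality_apply] at he
      exact (he j).symm

end Elementwise

/-! ### Infinite paths through trees -/

section Paths

theorem exists_forall_of_antitone {α : Type*} [Finite α] (P : ℕ → α → Prop)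
    (anti : ∀ k a, P (k + 1) a → P k a) (h : ∀ k, ∃ a, P k a) : ∃ a, ∀ k, P k a := by
  by_contra! H
  choose k hk using H
  obtain ⟨N, hN⟩ := (Set.finite_range k).bddAbove
  obtain ⟨a, ha⟩ := h N
  exact hk a (Nat.decreasingInduction' (P := fun n => P n a) (fun n _ _ => anti n a)
    (hN (Set.mem_range_self a)) ha)

/-- Dependent choice along a sequence of types, keeping an invariant `G`. -/
theorem exists_path {S : ℕ → Type*} (R : ∀ n, S n → S (n + 1) → Prop) (G : ∀ n, S n → Prop)
    (s : S 0) (hs : G 0 s) (step : ∀ n s, G n s → ∃ s', R n s s' ∧ G (n + 1) s') :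
    ∃ p : ∀ n, S n, p 0 = s ∧ ∀ n, G n (p n) ∧ R n (p n) (p (n + 1)) := by
  choose next hR hG using step
  let p : ∀ n, { s : S n // G n s } :=
    fun n => Nat.rec ⟨s, hs⟩ (fun n t => ⟨next n t.1 t.2, hG n t.1 t.2⟩) n
  exact ⟨fun n => (p n).1, rfl, fun n => ⟨(p n).2, hR n _ (p n).2⟩⟩

/-- A form of König's lemma. Read `G n k s` as a certificate that `s` can be prolonged `k` more
steps; with finitely many successors everywhere, certificates for all `k` yield an infinite path
that keeps all of them. -/
theorem exists_path_of_finite {S : ℕ → Type*} (R : ∀ n, S n → S (n + 1) → Prop)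
    (fin : ∀ n s, {s' | R n s s'}.Finite) (G : ∀ n, ℕ → S n → Prop)
    (anti : ∀ n k s, G n (k + 1) s → G n k s)
    (step : ∀ n k s, G n (k + 1) s → ∃ s', R n s s' ∧ G (n + 1) k s')
    (s : S 0) (hs : ∀ k, G 0 k s) :
    ∃ p : ∀ n, S n, p 0 = s ∧ ∀ n, (∀ k, G n k (p n)) ∧ R n (p n) (p (n + 1)) := by
  refine exists_path R (fun n s => ∀ k, G n k s) s hs fun n s hs => ?_
  have := (fin n s).to_subtype
  obtain ⟨a, ha⟩ := exists_forall_of_antitone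
    (fun k (a : {s' | R n s s'}) => G (n + 1) k a.1) (fun k a => anti _ _ _)
    (fun k => by
      obtain ⟨s', h, h'⟩ := step n k s (hs (k + 1))
      exact ⟨⟨s', h⟩, h'⟩)
  exact ⟨a.1, a.2, ha⟩

/-- An inverse system of nonempty sets in which every element has a predecessor, finite from level
one on, has an infinite path. -/
theorem exists_path_of_predecessors {S : ℕ → Type*} (R : ∀ n, S n → S (n + 1) → Prop)
    [∀ n, Finite (S (n + 1))] [∀ n, Nonempty (S n)]
    (pred : ∀ n s', ∃ s, R n s s') : ∃ p : ∀ n, S n, ∀ n, R n (p n) (p (n + 1)) := by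
  let T : ℕ → ∀ n, S n → Prop := fun k => Nat.rec (fun _ _ => True)
    (fun _ T n s => ∃ s', R n s s' ∧ T (n + 1) s') k
  have anti : ∀ k n s, T (k + 1) n s → T k n s := by
    intro k
    induction k with
    | zero => exact fun _ _ _ => trivial
    | succ k ih => exact fun n s ⟨s', h, h'⟩ => ⟨s', h, ih _ _ h'⟩
  have ex : ∀ k n, ∃ s, T k n s := by
    intro k
    induction k with
    | zero => exact fun n => ⟨Classical.arbitrary _, trivial⟩
    | succ k ih =>
      intro n
      obtain ⟨s', h'⟩ := ih (n + 1)
      obtain ⟨s, h⟩ := pred n s'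
      exact ⟨s, s', h, h'⟩
  obtain ⟨s₁, h₁⟩ := exists_forall_of_antitone (fun k (s : S 1) => T k 1 s)
    (fun k s => anti k 1 s) (fun k => ex k 1)
  obtain ⟨p, hp, hR⟩ := exists_path_of_finite (S := fun n => S (n + 1)) (fun n => R (n + 1))
    (fun n s => Set.toFinite _) (fun n k s => T k (n + 1) s) (fun n k s => anti k _ s)
    (fun n k s h => h) s₁ h₁
  obtain ⟨s₀, h₀⟩ := pred 0 s₁
  refine ⟨fun n => Nat.casesOn n s₀ p, fun n => ?_⟩
  cases n with
  | zero =>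
    change R 0 s₀ (p 0)
    rw [hp]
    exact h₀
  | succ n => exact (hR n).2

end Paths

/-! ### Modules and sequences -/

section Sequences

variable {A : Type u} [SmallCategory A] {M : CatModule A A}

namespace CatModule

@[simp] theorem lact_id {b a : A} (m : M.Elt b a) : M.lact (𝟙 a) m = m := by
  simp [lact]

theorem lact_comp {b a a' a'' : A} (f : a ⟶ a') (f' : a' ⟶ a'') (m : M.Elt b a) :
    M.lact (f ≫ f') m = M.lact f' (M.lact f m) :=
  (M.obj (op b)).map_comp_apply f f' m

@[simp] theorem ract_id {b a : A} (m : M.Elt b a) : M.ract m (𝟙 b) = m := by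
  simp [ract]

theorem ract_comp {b b' b'' a : A} (m : M.Elt b a) (g : b' ⟶ b) (g' : b'' ⟶ b') :
    M.ract m (g' ≫ g) = M.ract (M.ract m g) g' := by
  simp [ract]

theorem lact_ract {b b' a a' : A} (f : a ⟶ a') (m : M.Elt b a) (g : b' ⟶ b) :
    M.lact f (M.ract m g) = M.ract (M.lact f m) g :=
  (NatTrans.naturality_apply (M.map g.op) f m).symm

theorem IsFinite.elt (hM : M.IsFinite) (a : A) : Finite (Σ b : A, M.Elt b a) := by
  have := hM a
  refine Finite.of_injective
    (fun p : (Σ b : A, M.Elt b a) => (⟨p.1, p.1, 𝟙 _, p.2⟩ : Σ b' b : A, (b' ⟶ b) × M.Elt b a)) ?_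
  rintro ⟨b, m⟩ ⟨b', m'⟩ h
  simp only [Sigma.mk.injEq] at h
  obtain ⟨rfl, h⟩ := h
  simp at h
  simp [h]

theorem IsFinite.over (hM : M.IsFinite) {b a : A} (m : M.Elt b a) : Finite (Σ c : A, c ⟶ b) := by
  have := hM a
  refine Finite.of_injective
    (fun p : (Σ c : A, c ⟶ b) => (⟨p.1, b, p.2, m⟩ : Σ b' b : A, (b' ⟶ b) × M.Elt b a)) ?_
  rintro ⟨c, g⟩ ⟨c', g'⟩ h
  simp only [Sigma.mk.injEq] at h
  obtain ⟨rfl, h⟩ := h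
  simp at h
  simp [h]

theorem IsFinite.hom (hM : M.IsFinite) {b a : A} (m : M.Elt b a) (c : A) : Finite (c ⟶ b) := by
  have := hM.over m
  exact Finite.of_injective (fun g : c ⟶ b => (⟨c, g⟩ : Σ c : A, c ⟶ b))
    (fun g g' h => by simpa using h)

end CatModule

namespace InfSeq

/-- The sequence `⋯ ⇸ aⱼ₊₁ ⇸ aⱼ`. -/
def drop (s : InfSeq M) (j : ℕ) : InfSeq M where
  obj n := s.obj (j + n)
  elt n := s.elt (j + n)

/-- The sequence `⋯ ⇸ a₂ ⇸ a₁`. -/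
def tail (s : InfSeq M) : InfSeq M where
  obj n := s.obj (n + 1)
  elt n := s.elt (n + 1)

/-- The sequence `⋯ ⇸ a₁ ⇸ a₀ ⇸ a` prolonging a sequence by `m : a₀ ⇸ a`. -/
def cons {a : A} (s : InfSeq M) (m : M.Elt (s.obj 0) a) : InfSeq M where
  obj n := Nat.casesOn n a s.obj
  elt n := Nat.casesOn n m s.elt

theorem elt_cast (s : InfSeq M) {i j : ℕ} (h : i = j) :
    M.ract (s.elt j) (eqToHom (congrArg (fun n => s.obj (n + 1)) h)) =
      M.lact (eqToHom (congrArg s.obj h)) (s.elt i) := by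
  subst h
  simp

end InfSeq

namespace Ladder

/-- Composition of ladders. -/
def comp {s t r : InfSeq M} (f : Ladder s t) (g : Ladder t r) : Ladder s r where
  map n := f.map n ≫ g.map n
  comm n := by
    rw [CatModule.ract_comp, g.comm, ← CatModule.lact_ract, f.comm, CatModule.lact_comp]

/-- The ladder between the sequences starting at stage `j`. -/
def drop {s t : InfSeq M} (f : Ladder s t) (j : ℕ) : Ladder (s.drop j) (t.drop j) where
  map n := f.map (j + n)
  comm n := f.comm (j + n)

/-- The ladder between the sequences starting at stage one. -/
def tail {s t : InfSeq M} (f : Ladder s t) : Ladder s.tail t.tail where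
  map n := f.map (n + 1)
  comm n := f.comm (n + 1)

/-- The identity, as a ladder from the sequence starting at stage zero. -/
def dropZero (s : InfSeq M) : Ladder (s.drop 0) s where
  map n := eqToHom (congrArg s.obj (Nat.zero_add n))
  comm n := s.elt_cast (Nat.zero_add n)

/-- The identity between the two forms of the sequence starting at stage `j + 1`. -/
def tailDrop (s : InfSeq M) (j : ℕ) : Ladder (s.drop j).tail (s.drop (j + 1)) where
  map n := eqToHom (congrArg s.obj (by omega : j + (n + 1) = j + 1 + n))
  comm n := s.elt_cast (by omega : j + (n + 1) = j + 1 + n)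

/-- Prolonging a ladder by one square. -/
def cons {s t : InfSeq M} (f : Ladder s t) {a b : A} {m : M.Elt (s.obj 0) a}
    {m' : M.Elt (t.obj 0) b} (g : a ⟶ b) (h : M.ract m' (f.map 0) = M.lact g m) :
    Ladder (s.cons m) (t.cons m') where
  map n := Nat.casesOn n g f.map
  comm n := by
    cases n with
    | zero => exact h
    | succ n => exact f.comm n

/-- The identity ladder. -/
def id (s : InfSeq M) : Ladder s s where
  map n := 𝟙 _
  comm n := by simp

end Ladder

/-! ### Completing squares and forks of ladders -/

/-- Condition S1 is self-improving: applied to all stages of two ladders it gives a square at each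
stage; nondegeneracy of the module transports a square down one stage together with a crossed arrow,
and by finiteness of the module the squares can be chosen coherently. -/
theorem ConditionS1.exists_ladder_square (hM : IsSelfSimilaritySystem M) (hS : ConditionS1 M)
    {s s' t : InfSeq M} (f : Ladder s t) (f' : Ladder s' t) :
    ∃ (c : InfSeq M) (g : Ladder c s) (g' : Ladder c s'),
      ∀ n, g.map n ≫ f.map n = g'.map n ≫ f'.map n := by
  let S : ℕ → Type u := fun n =>
    Σ d : A, { p : (d ⟶ s.obj n) × (d ⟶ s'.obj n) // p.1 ≫ f.map n = p.2 ≫ f'.map n }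
  have fin : ∀ n, Finite (S (n + 1)) := by
    intro n
    have := hM.finite.over (s.elt n)
    have (d : A) := hM.finite.hom (s'.elt n) d
    refine Finite.of_injective
      (β := Σ p : (Σ c : A, c ⟶ s.obj (n + 1)), (p.1 ⟶ s'.obj (n + 1)))
      (fun p => ⟨⟨p.1, p.2.1.1⟩, p.2.1.2⟩) ?_
    rintro ⟨d, ⟨g, g'⟩, h⟩ ⟨d', ⟨k, k'⟩, h'⟩ e
    simp only [Sigma.mk.injEq] at e
    obtain ⟨⟨rfl, e⟩, e'⟩ := e
    simp only [heq_eq_eq] at e e'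
    subst e e'
    rfl
  have ne : ∀ n, Nonempty (S n) := by
    intro n
    obtain ⟨c, g, g', h⟩ := hS _ _ _ (f.drop n) (f'.drop n)
    exact ⟨⟨c, ⟨(g, g'), h⟩⟩⟩
  obtain ⟨p, hp⟩ := exists_path_of_predecessors (S := S)
    (fun n x x' => ∃ k : M.Elt x'.1 x.1,
      M.lact x.2.1.1 k = M.ract (s.elt n) x'.2.1.1 ∧
      M.lact x.2.1.2 k = M.ract (s'.elt n) x'.2.1.2)
    (by
      rintro n ⟨d, ⟨g, g'⟩, h⟩
      obtain ⟨c, k, k', m, hk, hm, hm'⟩ := (hM.nondegenerate d).componentwiseFlat.square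
        (f.map n) (f'.map n) (M.ract (s.elt n) g) (M.ract (s'.elt n) g') (by
          change M.lact _ _ = M.lact _ _
          rw [M.lact_ract, M.lact_ract, ← f.comm, ← f'.comm, ← M.ract_comp, ← M.ract_comp, h])
      exact ⟨⟨c, ⟨(k, k'), hk⟩⟩, m, hm, hm'⟩)
  choose k hk hk' using hp
  exact ⟨⟨fun n => (p n).1, k⟩, ⟨fun n => (p n).2.1.1, fun n => (hk n).symm⟩,
    ⟨fun n => (p n).2.1.2, fun n => (hk' n).symm⟩, fun n => (p n).2.2⟩

/-- The analogue for condition S2 and parallel ladders. -/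
theorem ConditionS2.exists_ladder_fork (hM : IsSelfSimilaritySystem M) (hS : ConditionS2 M)
    {s t : InfSeq M} (f f' : Ladder s t) :
    ∃ (c : InfSeq M) (g : Ladder c s), ∀ n, g.map n ≫ f.map n = g.map n ≫ f'.map n := by
  let S : ℕ → Type u := fun n =>
    Σ d : A, { g : d ⟶ s.obj n // g ≫ f.map n = g ≫ f'.map n }
  have fin : ∀ n, Finite (S (n + 1)) := by
    intro n
    have := hM.finite.over (s.elt n)
    refine Finite.of_injective (β := Σ c : A, c ⟶ s.obj (n + 1)) (fun p => ⟨p.1, p.2.1⟩) ?_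
    rintro ⟨d, g, h⟩ ⟨d', k, h'⟩ e
    simp only [Sigma.mk.injEq] at e
    obtain ⟨rfl, e⟩ := e
    simp only [heq_eq_eq] at e
    subst e
    rfl
  have ne : ∀ n, Nonempty (S n) := by
    intro n
    obtain ⟨c, g, h⟩ := hS _ _ (f.drop n) (f'.drop n)
    exact ⟨⟨c, g, h⟩⟩
  obtain ⟨p, hp⟩ := exists_path_of_predecessors (S := S)
    (fun n x x' => ∃ k : M.Elt x'.1 x.1, M.lact x.2.1 k = M.ract (s.elt n) x'.2.1)
    (by
      rintro n ⟨d, g, h⟩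
      obtain ⟨c, k, m, hk, hm⟩ := (hM.nondegenerate d).componentwiseFlat.fork
        (f.map n) (f'.map n) (M.ract (s.elt n) g) (by
          change M.lact _ _ = M.lact _ _
          rw [M.lact_ract, M.lact_ract, ← f.comm, ← f'.comm, ← M.ract_comp, ← M.ract_comp, h])
      exact ⟨⟨c, k, hk⟩, m, hm⟩)
  choose k hk using hp
  exact ⟨⟨fun n => (p n).1, k⟩, ⟨fun n => (p n).2.1, fun n => (hk n).symm⟩, fun n => (p n).2.2⟩

end Sequences

/-! ### Unfolding elements of coalgebras -/

section Unfolding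

variable {A : Type u} [SmallCategory A] {M : CatModule A A} {X : A ⥤ Type u}

/-- `Unfolds ξ x m y` says that `ξ x = m ⊗ y`. -/
def Unfolds (ξ : X ⟶ (tensorSet M).obj X) {a b : A} (x : X.obj a) (m : M.Elt b a) (y : X.obj b) :
    Prop :=
  (ξ.app a x : Tensor (M.flip.obj a) X) = Tensor.mk (Y := M.flip.obj a) m y

variable {ξ : X ⟶ (tensorSet M).obj X}

theorem exists_unfolds (ξ : X ⟶ (tensorSet M).obj X) {a : A} (x : X.obj a) :
    ∃ (b : A) (m : M.Elt b a) (y : X.obj b), Unfolds ξ x m y := by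
  unfold Unfolds
  generalize (ξ.app a x : Tensor (M.flip.obj a) X) = t
  induction t using Tensor.ind with
  | h b m y => exact ⟨b, m, y, rfl⟩

theorem Unfolds.map {a b : A} {x : X.obj a} {m : M.Elt b a} {y : X.obj b} (h : Unfolds ξ x m y)
    {a' : A} (f : a ⟶ a') : Unfolds ξ (X.map f x) (M.lact f m) y := by
  unfold Unfolds at *
  have := NatTrans.naturality_apply ξ f x
  refine this.trans ?_
  change Tensor.map (M.flip.map f) (𝟙 X) (ξ.app a x : Tensor (M.flip.obj a) X) = _
  rw [h, Tensor.map_mk]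
  rfl

theorem unfolds_ract_iff {a b c : A} {x : X.obj a} {m : M.Elt b a} {g : c ⟶ b} {y : X.obj c} :
    Unfolds ξ x (M.ract m g) y ↔ Unfolds ξ x m (X.map g y) := by
  unfold Unfolds
  rw [← Tensor.glue]
  rfl

theorem Unfolds.exists_span (hX : ComponentwiseFlat X) {a b b' : A} {x : X.obj a} {m : M.Elt b a}
    {y : X.obj b} {m' : M.Elt b' a} {y' : X.obj b'} (h : Unfolds ξ x m y)
    (h' : Unfolds ξ x m' y') : ∃ (c : A) (g : c ⟶ b) (g' : c ⟶ b') (z : X.obj c),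
      M.ract m g = M.ract m' g' ∧ X.map g z = y ∧ X.map g' z = y' :=
  hX.mk_eq_mk_iff.1 (h.symm.trans h')

/-- An unfolding of `z` can be refined so as to lie over a given unfolding of `g z`. -/
theorem Unfolds.exists_lift (hX : ComponentwiseFlat X) {a d b e : A} {g : d ⟶ a} {z : X.obj d}
    {m : M.Elt b a} {y : X.obj b} {k : M.Elt e d} {w : X.obj e}
    (h : Unfolds ξ (X.map g z) m y) (h' : Unfolds ξ z k w) :
    ∃ (c : A) (l : c ⟶ e) (g' : c ⟶ b) (v : X.obj c), Unfolds ξ z (M.ract k l) v ∧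
      X.map l v = w ∧ M.lact g (M.ract k l) = M.ract m g' ∧ X.map g' v = y := by
  obtain ⟨c, l, g', v, hc, hl, hg⟩ := (h'.map g).exists_span hX h
  exact ⟨c, l, g', v, unfolds_ract_iff.2 (hl ▸ h'), hl, by rw [M.lact_ract, hc], hg⟩

/-- A resolution in a coalgebra: a sequence of module elements together with elements of the
coalgebra, each of which unfolds to the next along the sequence. -/
structure Resolution (ξ : X ⟶ (tensorSet M).obj X) where
  seq : InfSeq M
  elt : ∀ n, X.obj (seq.obj n)
  unfolds : ∀ n, Unfolds ξ (elt n) (seq.elt n) (elt (n + 1))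

/-- The resolution starting at stage one. -/
def Resolution.tail (r : Resolution ξ) : Resolution ξ where
  seq := r.seq.tail
  elt n := r.elt (n + 1)
  unfolds n := r.unfolds (n + 1)

theorem exists_resolution (ξ : X ⟶ (tensorSet M).obj X) {a : A} (x : X.obj a) :
    ∃ (r : Resolution ξ) (f : r.seq.obj 0 ⟶ a), X.map f (r.elt 0) = x := by
  obtain ⟨p, hp, h⟩ := exists_path (S := fun _ => Σ a : A, X.obj a)
    (fun _ p q => ∃ m : M.Elt q.1 p.1, Unfolds ξ p.2 m q.2) (fun _ _ => True) ⟨a, x⟩ trivial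
    (fun _ p _ => by
      obtain ⟨b, m, y, h⟩ := exists_unfolds ξ p.2
      exact ⟨⟨b, y⟩, ⟨m, h⟩, trivial⟩)
  choose m hm using fun n => (h n).2
  have h₀ : ∃ f : (p 0).1 ⟶ a, X.map f (p 0).2 = x := by
    rw [hp]
    exact ⟨𝟙 a, by simp⟩
  obtain ⟨f, hf⟩ := h₀
  exact ⟨⟨⟨fun n => (p n).1, m⟩, fun n => (p n).2, hm⟩, f, hf⟩

/-- Two resolutions of an element of a componentwise flat coalgebra have a common refinement. -/
theorem Resolution.exists_ladders (hX : ComponentwiseFlat X) (r r' : Resolution ξ) {a : A}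
    {f : r.seq.obj 0 ⟶ a} {f' : r'.seq.obj 0 ⟶ a}
    (h : X.map f (r.elt 0) = X.map f' (r'.elt 0)) :
    ∃ (c : InfSeq M) (g : Ladder c r.seq) (g' : Ladder c r'.seq),
      g.map 0 ≫ f = g'.map 0 ≫ f' := by
  obtain ⟨c₀, g₀, g₀', z₀, hc₀, hz₀, hz₀'⟩ := hX.square f f' _ _ h
  obtain ⟨p, hp, h⟩ := exists_path
    (S := fun n => Σ d : A, (d ⟶ r.seq.obj n) × (d ⟶ r'.seq.obj n) × X.obj d)
    (fun n p q => ∃ k : M.Elt q.1 p.1,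
      M.lact p.2.1 k = M.ract (r.seq.elt n) q.2.1 ∧
      M.lact p.2.2.1 k = M.ract (r'.seq.elt n) q.2.2.1)
    (fun n p => X.map p.2.1 p.2.2.2 = r.elt n ∧ X.map p.2.2.1 p.2.2.2 = r'.elt n)
    ⟨c₀, g₀, g₀', z₀⟩ ⟨hz₀, hz₀'⟩
    (by
      rintro n ⟨d, g, g', z⟩ ⟨hz, hz'⟩
      obtain ⟨e, k, w, hk⟩ := exists_unfolds ξ z
      dsimp only at hz hz'
      have hr := r.unfolds n
      rw [← hz] at hr
      obtain ⟨c, l, q, v, hv, -, hq, hqv⟩ := hr.exists_lift hX hk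
      have hr' := r'.unfolds n
      rw [← hz'] at hr'
      obtain ⟨c', l', q', v', hv', hl', hq', hqv'⟩ := hr'.exists_lift hX hv
      refine ⟨⟨c', l' ≫ q, q', v'⟩, ⟨_, ?_, hq'⟩, ?_, hqv'⟩
      · rw [M.lact_ract, hq, M.ract_comp]
      · simp [hl', hqv])
  choose k hk hk' using fun n => (h n).2
  refine ⟨⟨fun n => (p n).1, k⟩, ⟨fun n => (p n).2.1, fun n => (hk n).symm⟩,
    ⟨fun n => (p n).2.2.1, fun n => (hk' n).symm⟩, ?_⟩
  change (p 0).2.1 ≫ f = (p 0).2.2.1 ≫ f'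
  rw [hp]
  exact hc₀

end Unfolding

/-! ### The universal solution in sets -/

section Solution

variable {A : Type u} [SmallCategory A]

/-- The relation generating the identification of sequences in the universal solution: a ladder
from `s` to `t` identifies `(s, g₀ f)` with `(t, f)`. -/
inductive SolRel (M : CatModule A A) (a : A) :
    (Σ s : InfSeq M, s.obj 0 ⟶ a) → (Σ s : InfSeq M, s.obj 0 ⟶ a) → Prop
  | ladder {s t : InfSeq M} (g : Ladder s t) (f : t.obj 0 ⟶ a) :
      SolRel M a ⟨s, g.map 0 ≫ f⟩ ⟨t, f⟩

/-- The colimit of the representables `A(a₀, -)` over all sequences `⋯ ⇸ a₁ ⇸ a₀`, contravariantly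
in ladders. Its value at `a` is the set of connected components of sequences ending at `a`: a pair
`(s, f : a₀ ⟶ a)` stands for the sequence `s` with its last element composed with `f`. -/
def sol (M : CatModule A A) : A ⥤ Type u where
  obj a := Quot (SolRel M a)
  map {a a'} h := ↾(Quot.map (fun p => ⟨p.1, p.2 ≫ h⟩) (by
    rintro _ _ ⟨g, f⟩
    simpa using SolRel.ladder g (f ≫ h)))
  map_id a := by
    ext t
    obtain ⟨s, f⟩ := t
    simp [Quot.map]
  map_comp h h' := by
    ext t
    obtain ⟨s, f⟩ := t
    simp [Quot.map]

variable {M : CatModule A A}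

/-- The class of the pair `(s, f)`. -/
def sol.mk {a : A} (s : InfSeq M) (f : s.obj 0 ⟶ a) : (sol M).obj a := Quot.mk _ ⟨s, f⟩

theorem sol.exists_rep {a : A} (t : (sol M).obj a) : ∃ s f, t = sol.mk s f := by
  obtain ⟨s, f⟩ := t
  exact ⟨s, f, rfl⟩

theorem sol.map_mk {a a' : A} (h : a ⟶ a') (s : InfSeq M) (f : s.obj 0 ⟶ a) :
    (sol M).map h (sol.mk s f) = sol.mk s (f ≫ h) := rfl

theorem sol.ladder {a : A} {s t : InfSeq M} (g : Ladder s t) (f : t.obj 0 ⟶ a) :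
    sol.mk s (g.map 0 ≫ f) = sol.mk t f :=
  Quot.sound (SolRel.ladder g f)

theorem sol.mk_eq_of_ladder {a : A} {s t : InfSeq M} (g : Ladder s t) {f : t.obj 0 ⟶ a}
    {f' : s.obj 0 ⟶ a} (h : g.map 0 ≫ f = f') : sol.mk s f' = sol.mk t f :=
  h ▸ sol.ladder g f

/-- Under condition S1, identified sequences are linked by a single span of ladders. -/
theorem sol.mk_eq_mk_iff (hM : IsSelfSimilaritySystem M) (hS : ConditionS1 M) {a : A}
    {s s' : InfSeq M} {f : s.obj 0 ⟶ a} {f' : s'.obj 0 ⟶ a} :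
    sol.mk s f = sol.mk s' f' ↔ ∃ (c : InfSeq M) (g : Ladder c s) (g' : Ladder c s'),
      g.map 0 ≫ f = g'.map 0 ≫ f' := by
  constructor
  · intro h
    have key : ∀ p q : (Σ s : InfSeq M, s.obj 0 ⟶ a), Relation.EqvGen (SolRel M a) p q →
        ∃ (c : InfSeq M) (g : Ladder c p.1) (g' : Ladder c q.1),
          g.map 0 ≫ p.2 = g'.map 0 ≫ q.2 := by
      intro p q hpq
      induction hpq with
      | rel p q h =>
        obtain ⟨g, f⟩ := h
        exact ⟨_, Ladder.id _, g, by simp [Ladder.id]⟩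
      | refl p => exact ⟨_, Ladder.id _, Ladder.id _, rfl⟩
      | symm p q _ ih =>
        obtain ⟨c, g, g', h⟩ := ih
        exact ⟨c, g', g, h.symm⟩
      | trans p q r _ _ ih ih' =>
        obtain ⟨c, g, g', h⟩ := ih
        obtain ⟨d, k, k', h'⟩ := ih'
        obtain ⟨e, l, l', hl⟩ := hS.exists_ladder_square hM g' k
        refine ⟨e, l.comp g, l'.comp k', ?_⟩
        simp only [Ladder.comp, Category.assoc, h, ← h']
        simp only [← Category.assoc, hl]
    exact key _ _ (Quot.eqvGen_exact h)
  · rintro ⟨c, g, g', h⟩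
    rw [← sol.ladder g, ← sol.ladder g', h]

/-- The solution is nondegenerate, because spans and forks of ladders can be completed. -/
theorem sol.componentwiseFlat (hM : IsSelfSimilaritySystem M) (hS : ConditionS M) :
    ComponentwiseFlat (sol M) where
  square {a a' b} f f' x x' h := by
    obtain ⟨s, k, rfl⟩ := sol.exists_rep x
    obtain ⟨s', k', rfl⟩ := sol.exists_rep x'
    obtain ⟨c, g, g', hc⟩ := (sol.mk_eq_mk_iff hM hS.1).1 h
    refine ⟨c.obj 0, g.map 0 ≫ k, g'.map 0 ≫ k', sol.mk c (𝟙 _), by simpa using hc, ?_, ?_⟩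
    · rw [sol.map_mk, Category.id_comp, sol.ladder]
    · rw [sol.map_mk, Category.id_comp, sol.ladder]
  fork {a b} f f' x h := by
    obtain ⟨s, k, rfl⟩ := sol.exists_rep x
    obtain ⟨c, g, g', hc⟩ := (sol.mk_eq_mk_iff hM hS.1).1 h
    obtain ⟨d, e, he⟩ := hS.2.exists_ladder_fork hM g g'
    refine ⟨d.obj 0, e.map 0 ≫ g.map 0 ≫ k, sol.mk d (𝟙 _), ?_, ?_⟩
    · simp only [Category.assoc, hc]
      rw [reassoc_of% (he 0)]
    · rw [sol.map_mk, Category.id_comp, sol.ladder, sol.ladder]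

/-- The structure map, which splits off the last element of a sequence. -/
def solStr (M : CatModule A A) : sol M ⟶ (tensorSet M).obj (sol M) where
  app a := ↾(Quot.lift (fun p => (Tensor.mk (Y := M.flip.obj a) (M.lact p.2 (p.1.elt 0))
      (sol.mk p.1.tail (𝟙 _)) : Tensor (M.flip.obj a) (sol M))) (by
    rintro _ _ ⟨g, f⟩
    dsimp only
    rw [M.lact_comp, ← g.comm, M.lact_ract]
    refine (Tensor.glue (Y := M.flip.obj a) (X := sol M) _ _ _).trans ?_
    congr 1
    exact sol.mk_eq_of_ladder g.tail
      (show g.tail.map 0 ≫ 𝟙 _ = 𝟙 _ ≫ g.tail.map 0 from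
        (Category.comp_id _).trans (Category.id_comp _).symm)))
  naturality a a' h := by
    ext t
    obtain ⟨s, f⟩ := t
    change Tensor.mk (Y := M.flip.obj a') (M.lact (f ≫ h) (s.elt 0)) _ =
      Tensor.map (M.flip.map h) (𝟙 _) (Tensor.mk (Y := M.flip.obj a) (M.lact f (s.elt 0)) _)
    rw [M.lact_comp, Tensor.map_mk]
    rfl

theorem unfolds_mk {a : A} (s : InfSeq M) (f : s.obj 0 ⟶ a) :
    Unfolds (solStr M) (sol.mk s f) (M.lact f (s.elt 0)) (sol.mk s.tail (𝟙 _)) := rfl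

/-- The inverse of the structure map, `m ⊗ t ↦ m t`: prolonging a sequence by one element. -/
def sol.act {a b : A} (m : M.Elt b a) : (sol M).obj b → (sol M).obj a :=
  Quot.lift (fun p => sol.mk (p.1.cons (M.ract m p.2)) (𝟙 a)) (by
    rintro _ _ ⟨g, f⟩
    exact sol.mk_eq_of_ladder (g.cons (𝟙 a) (m := M.ract m (g.map 0 ≫ f)) (m' := M.ract m f)
      (by simp [M.ract_comp])) (Category.comp_id (𝟙 a)))

theorem sol.act_mk {a b : A} (m : M.Elt b a) (s : InfSeq M) (f : s.obj 0 ⟶ b) :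
    sol.act m (sol.mk s f) = sol.mk (s.cons (M.ract m f)) (𝟙 a) := rfl

theorem sol.act_ract {a b c : A} (m : M.Elt b a) (g : c ⟶ b) (t : (sol M).obj c) :
    sol.act (M.ract m g) t = sol.act m ((sol M).map g t) := by
  obtain ⟨s, f, rfl⟩ := sol.exists_rep t
  rw [sol.map_mk, sol.act_mk, sol.act_mk, M.ract_comp]

theorem sol.mk_eq_act {a : A} (s : InfSeq M) (f : s.obj 0 ⟶ a) :
    sol.mk s f = sol.act (M.lact f (s.elt 0)) (sol.mk s.tail (𝟙 _)) := by
  let g : Ladder s (s.tail.cons (M.ract (M.lact f (s.elt 0)) (𝟙 (s.obj 1)))) :=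
    { map := fun n => Nat.casesOn n f (fun n => 𝟙 (s.obj (n + 1)))
      comm := fun n => by
        cases n with
        | zero => exact (M.ract_id _).trans (M.ract_id _)
        | succ n => exact (M.ract_id _).trans (M.lact_id _).symm }
  exact sol.mk_eq_of_ladder g (Category.comp_id f)

theorem unfolds_solStr_iff {a b : A} {t : (sol M).obj a} {m : M.Elt b a} {t' : (sol M).obj b} :
    Unfolds (solStr M) t m t' ↔ t = sol.act m t' := by
  let inv : Tensor (M.flip.obj a) (sol M) → (sol M).obj a :=
    Quot.lift (fun p => sol.act (show M.Elt p.1.1 a from p.1.2) p.2) (by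
      rintro _ _ ⟨g, m, t⟩
      exact sol.act_ract m g t)
  have h_inv : ∀ t, inv ((solStr M).app a t) = t := by
    intro t
    obtain ⟨s, f, rfl⟩ := sol.exists_rep t
    exact (sol.mk_eq_act s f).symm
  constructor
  · intro h
    have := congrArg inv h
    rw [h_inv] at this
    exact this
  · rintro rfl
    obtain ⟨s, f, rfl⟩ := sol.exists_rep t'
    have : Unfolds (solStr M) (sol.act m (sol.mk s f)) (M.lact (𝟙 a) (M.ract m f))
        (sol.mk s (𝟙 _)) := unfolds_mk (s.cons (M.ract m f)) (𝟙 a)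
    rw [M.lact_id, unfolds_ract_iff, sol.map_mk, Category.id_comp] at this
    exact this

theorem sol.map_act {a a' b : A} (f : a ⟶ a') (m : M.Elt b a) (t : (sol M).obj b) :
    (sol M).map f (sol.act m t) = sol.act (M.lact f m) t :=
  unfolds_solStr_iff.1 ((unfolds_solStr_iff.2 rfl).map f)

/-- The tautological resolution of the class of a sequence, by its own tails. -/
def tautResolution (s : InfSeq M) : Resolution (solStr M) where
  seq := s
  elt j := sol.mk (s.drop j) (𝟙 _)
  unfolds j := by
    have h : Unfolds (solStr M) (sol.mk (s.drop j) (𝟙 _)) (s.elt j)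
        (sol.mk (s.drop j).tail (𝟙 _)) :=
      (M.lact_id (s.elt j) ▸ unfolds_mk (s.drop j) (𝟙 _) :)
    have h' : sol.mk (s.drop j).tail (𝟙 _) = sol.mk (s.drop (j + 1)) (𝟙 _) :=
      sol.mk_eq_of_ladder (Ladder.tailDrop s j) (Category.comp_id _)
    exact h' ▸ h

theorem map_tautResolution (s : InfSeq M) {a : A} (f : s.obj 0 ⟶ a) :
    (sol M).map f ((tautResolution s).elt 0) = sol.mk s f :=
  sol.mk_eq_of_ladder (Ladder.dropZero s) (f' := 𝟙 _ ≫ f) rfl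

variable {X : A ⥤ Type u} {ξ : X ⟶ (tensorSet M).obj X}

/-- The classes of two resolutions of the same element agree. -/
theorem Resolution.mk_eq_mk (hX : ComponentwiseFlat X) (r r' : Resolution ξ) {a : A}
    {f : r.seq.obj 0 ⟶ a} {f' : r'.seq.obj 0 ⟶ a}
    (h : X.map f (r.elt 0) = X.map f' (r'.elt 0)) : sol.mk r.seq f = sol.mk r'.seq f' := by
  obtain ⟨c, g, g', h⟩ := r.exists_ladders hX r' h
  rw [← sol.ladder g, ← sol.ladder g', h]

/-- The map from a nondegenerate coalgebra to the solution, sending an element to the class of any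
of its resolutions. -/
noncomputable def toSol (hX : ComponentwiseFlat X) (ξ : X ⟶ (tensorSet M).obj X) : X ⟶ sol M where
  app a := ↾fun x => sol.mk (exists_resolution ξ x).choose.seq
    (exists_resolution ξ x).choose_spec.choose
  naturality a a' f := by
    ext x
    refine Resolution.mk_eq_mk hX _ _ (f' := _ ≫ f) ?_
    rw [(exists_resolution ξ (X.map f x)).choose_spec.choose_spec, X.map_comp_apply,
      (exists_resolution ξ x).choose_spec.choose_spec]

theorem toSol_map (hX : ComponentwiseFlat X) (r : Resolution ξ) {a : A} (f : r.seq.obj 0 ⟶ a) :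
    (toSol hX ξ).app a (X.map f (r.elt 0)) = sol.mk r.seq f :=
  Resolution.mk_eq_mk hX _ _ (exists_resolution ξ _).choose_spec.choose_spec

theorem toSol_comm (hX : ComponentwiseFlat X) (ξ : X ⟶ (tensorSet M).obj X) :
    ξ ≫ (tensorSet M).map (toSol hX ξ) = toSol hX ξ ≫ solStr M := by
  ext a x
  obtain ⟨r, f, rfl⟩ := exists_resolution ξ x
  have h₁ : Unfolds ξ (X.map f (r.elt 0)) _ _ := (r.unfolds 0).map f
  have h₂ := unfolds_mk r.seq f
  rw [← toSol_map hX] at h₂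
  refine Eq.trans (congrArg (Tensor.map (𝟙 _) (toSol hX ξ)) h₁) (Eq.trans ?_ h₂.symm)
  rw [Tensor.map_mk]
  have h₃ : (toSol hX ξ).app _ (r.elt 1) = sol.mk r.seq.tail (𝟙 _) := by
    have := toSol_map hX r.tail (𝟙 _)
    rwa [X.map_id_apply] at this
  rw [h₃]
  rfl

/-- Coalgebra maps preserve unfoldings. -/
theorem Unfolds.mapHom {X' : A ⥤ Type u} {ξ' : X' ⟶ (tensorSet M).obj X'} {α : X ⟶ X'}
    (hα : ξ ≫ (tensorSet M).map α = α ≫ ξ') {a b : A} {x : X.obj a} {m : M.Elt b a} {y : X.obj b}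
    (h : Unfolds ξ x m y) : Unfolds ξ' (α.app a x) m (α.app b y) := by
  have h₁ := congrArg (fun k => k.app a x) hα
  refine h₁.symm.trans ?_
  exact congrArg (Tensor.map (𝟙 _) α) h

/-- An element of the solution is the class of each of its resolutions, since it is the class of its
tautological one. -/
theorem Resolution.elt_zero_eq (hM : IsSelfSimilaritySystem M) (hS : ConditionS M)
    (r : Resolution (solStr M)) : r.elt 0 = sol.mk r.seq (𝟙 _) := by
  obtain ⟨s, f, h⟩ := sol.exists_rep (r.elt 0)
  rw [h]
  refine Resolution.mk_eq_mk (sol.componentwiseFlat hM hS) (tautResolution s) r ?_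
  refine (map_tautResolution s f).trans ?_
  rw [← h, (sol M).map_id_apply]

theorem eq_toSol (hM : IsSelfSimilaritySystem M) (hS : ConditionS M) (hX : ComponentwiseFlat X)
    (α : X ⟶ sol M) (hα : ξ ≫ (tensorSet M).map α = α ≫ solStr M) : α = toSol hX ξ := by
  refine NatTrans.ext (funext fun a => ConcreteCategory.hom_ext _ _ fun x => ?_)
  obtain ⟨r, f, rfl⟩ := exists_resolution ξ x
  let r' : Resolution (solStr M) :=
    ⟨r.seq, fun n => α.app _ (r.elt n), fun n => (r.unfolds n).mapHom hα⟩
  have h : α.app _ (r.elt 0) = sol.mk r.seq (𝟙 _) := r'.elt_zero_eq hM hS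
  rw [toSol_map, NatTrans.naturality_apply, h, sol.map_mk, Category.id_comp]

end Solution

/-! ### Closed sets of the universal solution -/

section ClosedSets

variable {A : Type u} [SmallCategory A] {M : CatModule A A}

/-- The elements of the solution at `aⱼ` that can be written as `mⱼ mⱼ₊₁ ⋯ mⱼ₊ₙ₋₁ y`. -/
def sol.cylinder (s : InfSeq M) : ℕ → ∀ j, Set ((sol M).obj (s.obj j))
  | 0, _ => Set.univ
  | n + 1, j => sol.act (s.elt j) '' sol.cylinder s n (j + 1)

theorem sol.cylinder_succ_subset (s : InfSeq M) (n j : ℕ) :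
    sol.cylinder s (n + 1) j ⊆ sol.cylinder s n j := by
  induction n generalizing j with
  | zero => exact Set.subset_univ _
  | succ n ih => exact Set.image_mono (ih (j + 1))

theorem sol.cylinder_subset_of_le (s : InfSeq M) {n k : ℕ} (h : n ≤ k) (j : ℕ) :
    sol.cylinder s k j ⊆ sol.cylinder s n j := by
  induction k, h using Nat.le_induction with
  | base => exact subset_rfl
  | succ k _ ih => exact (sol.cylinder_succ_subset s k j).trans ih

theorem sol.cylinder_tail_cons (s : InfSeq M) {a : A} (m : M.Elt (s.obj 1) a) (n j : ℕ) :
    sol.cylinder (s.tail.cons m) n (j + 1) = sol.cylinder s n (j + 1) := by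
  induction n generalizing j with
  | zero => rfl
  | succ n ih => exact congrArg (sol.act (s.elt (j + 1)) '' ·) (ih (j + 1))

/-- If `C` meets all cylinders around a sequence, then it contains the class of that sequence. This
says that the preimage of `C` in the profinite space of sequences is closed. -/
def sol.IsLimitClosed {a : A} (C : Set ((sol M).obj a)) : Prop :=
  ∀ (s : InfSeq M) (h : s.obj 0 ⟶ a),
    (∀ n, ∃ y ∈ sol.cylinder s n 0, (sol M).map h y ∈ C) → sol.mk s h ∈ C

/-- The quotient topology from the profinite space of sequences. -/
instance solTopology (a : A) : TopologicalSpace ((sol M).obj a) :=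
  TopologicalSpace.ofClosed {C | sol.IsLimitClosed C}
    (fun _ _ h => (h 0).choose_spec.2.elim)
    (fun T hT s h H C hC => hT hC s h fun n => by
      obtain ⟨y, hy, hy'⟩ := H n
      exact ⟨y, hy, hy' C hC⟩)
    (by
      intro C hC D hD s h H
      have anti : ∀ E : Set ((sol M).obj a), ∀ n k, n ≤ k →
          (∃ y ∈ sol.cylinder s k 0, (sol M).map h y ∈ E) →
          ∃ y ∈ sol.cylinder s n 0, (sol M).map h y ∈ E := by
        rintro E n k hnk ⟨y, hy, hy'⟩
        exact ⟨y, sol.cylinder_subset_of_le s hnk 0 hy, hy'⟩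
      by_contra! hne
      simp only [Set.mem_union, not_or] at hne
      obtain ⟨n, hn⟩ := not_forall.1 (mt (hC s h) hne.1)
      obtain ⟨k, hk⟩ := not_forall.1 (mt (hD s h) hne.2)
      obtain ⟨y, hy, hy' | hy'⟩ := H (max n k)
      · exact hn (anti C _ _ (le_max_left n k) ⟨y, hy, hy'⟩)
      · exact hk (anti D _ _ (le_max_right n k) ⟨y, hy, hy'⟩))

theorem sol.isClosed_iff {a : A} {C : Set ((sol M).obj a)} : IsClosed C ↔ sol.IsLimitClosed C := by
  rw [← isOpen_compl_iff]
  change Cᶜᶜ ∈ {C | sol.IsLimitClosed C} ↔ _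
  rw [compl_compl]
  rfl

theorem sol.continuous_map {a a' : A} (f : a ⟶ a') : Continuous ((sol M).map f) := by
  refine continuous_iff_isClosed.2 fun C hC => sol.isClosed_iff.2 fun s h H => ?_
  refine sol.isClosed_iff.1 hC s (h ≫ f) fun n => ?_
  obtain ⟨y, hy, hy'⟩ := H n
  exact ⟨y, hy, by rw [(sol M).map_comp_apply]; exact hy'⟩

/-- A branch all of whose stages `C j` are inhabited meets every cylinder around its sequence. -/
theorem sol.exists_mem_cylinder (s : InfSeq M) (C : ∀ j, Set ((sol M).obj (s.obj j)))
    (ne : ∀ j, (C j).Nonempty) (hC : ∀ j, ∀ y ∈ C (j + 1), sol.act (s.elt j) y ∈ C j) (n j : ℕ) :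
    ∃ y ∈ sol.cylinder s n j, y ∈ C j := by
  induction n generalizing j with
  | zero =>
    obtain ⟨y, hy⟩ := ne j
    exact ⟨y, Set.mem_univ y, hy⟩
  | succ n ih =>
    obtain ⟨y, hy, hy'⟩ := ih (j + 1)
    exact ⟨_, Set.mem_image_of_mem _ hy, hC j y hy'⟩

/-- Compactness for images: if the image of a closed set `C` meets all cylinders around a sequence,
it contains the class of that sequence. A branch is sought through stages `(d, g, C')` where
`g : d ⟶ aₙ` and `C'` is the pullback of `C` to `d`; those that go on for `k` more steps have an
element of `C'` mapping into the `k`-th cylinder. -/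
theorem sol.exists_map_eq_mk (hM : IsSelfSimilaritySystem M) (hS : ConditionS M) {a : A}
    {C : Set ((sol M).obj a)} (hC : sol.IsLimitClosed C) (s : InfSeq M) (f : a ⟶ s.obj 0)
    (h : ∀ n, ∃ x ∈ C, (sol M).map f x ∈ sol.cylinder s n 0) :
    ∃ x ∈ C, (sol M).map f x = sol.mk s (𝟙 _) := by
  have flat := sol.componentwiseFlat hM hS
  obtain ⟨p, hp, H⟩ := exists_path_of_finite
    (S := fun n => Σ d : A, (d ⟶ s.obj n) × Set ((sol M).obj d))
    (fun n p q => ∃ k : M.Elt q.1 p.1, M.lact p.2.1 k = M.ract (s.elt n) q.2.1 ∧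
      q.2.2 = {y | sol.act k y ∈ p.2.2})
    (by
      rintro n ⟨d, g, D⟩
      have := hM.finite.elt d
      have (c : A) := hM.finite.hom (s.elt n) c
      refine (Set.finite_range fun x : (Σ e : (Σ b : A, M.Elt b d), (e.1 ⟶ s.obj (n + 1))) =>
        (⟨x.1.1, x.2, {y | sol.act x.1.2 y ∈ D}⟩ :
          Σ d : A, (d ⟶ s.obj (n + 1)) × Set ((sol M).obj d))).subset ?_
      rintro ⟨d', g', D'⟩ ⟨k, -, hD⟩
      exact ⟨⟨⟨d', k⟩, g'⟩, congrArg (fun E : Set ((sol M).obj d') =>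
        (⟨d', g', E⟩ : Σ d : A, (d ⟶ s.obj (n + 1)) × Set ((sol M).obj d))) hD.symm⟩)
    (fun n k p => ∃ y ∈ p.2.2, (sol M).map p.2.1 y ∈ sol.cylinder s k n)
    (fun n k p ⟨y, hy, hy'⟩ => ⟨y, hy, sol.cylinder_succ_subset s k n hy'⟩)
    (by
      rintro n k ⟨d, g, D⟩ ⟨y, hy, z, hz, hzy⟩
      obtain ⟨e, l, w, hl⟩ := exists_unfolds (solStr M) y
      obtain ⟨c, q, g', v, hv, -, hg, hgv⟩ :=
        (unfolds_solStr_iff.2 hzy.symm).exists_lift flat hl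
      refine ⟨⟨c, g', {t | sol.act (M.ract l q) t ∈ D}⟩, ⟨_, hg, rfl⟩, v, ?_, ?_⟩
      · rw [unfolds_solStr_iff] at hv
        change sol.act _ v ∈ D
        rw [← hv]
        exact hy
      · exact hgv ▸ hz)
    ⟨a, f, C⟩ h
  choose k hk hkC using fun n => (H n).2
  let c : InfSeq M := ⟨fun n => (p n).1, k⟩
  let g : Ladder c s := ⟨fun n => (p n).2.1, fun n => (hk n).symm⟩
  have h₀ : ∃ e : (p 0).1 ⟶ a, (p 0).2.1 = e ≫ f ∧ ∀ y ∈ (p 0).2.2, (sol M).map e y ∈ C := by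
    rw [hp]
    exact ⟨𝟙 a, by simp, fun y hy => by simpa using hy⟩
  obtain ⟨e, he, heC⟩ := h₀
  refine ⟨sol.mk c e, hC c e fun n => ?_, ?_⟩
  · obtain ⟨y, hy, hy'⟩ := sol.exists_mem_cylinder c (fun n => (p n).2.2)
      (fun j => by
        obtain ⟨y, hy, -⟩ := (H j).1 0
        exact ⟨y, hy⟩)
      (fun j y hy => by
        rw [hkC j] at hy
        exact hy) n 0
    exact ⟨y, hy, heC y hy'⟩
  · rw [sol.map_mk]
    exact sol.mk_eq_of_ladder g ((Category.comp_id _).trans he)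

theorem sol.isClosedMap_map (hM : IsSelfSimilaritySystem M) (hS : ConditionS M) {a a' : A}
    (f : a ⟶ a') : IsClosedMap ((sol M).map f) := by
  intro C hC
  refine sol.isClosed_iff.2 fun s h H => ?_
  -- Absorbing `h` into the first element of `s` makes the sequence end at `a'` itself.
  obtain ⟨x, hx, hx'⟩ := sol.exists_map_eq_mk hM hS (sol.isClosed_iff.1 hC)
    (s.tail.cons (M.lact h (s.elt 0))) f (by
      intro n
      obtain ⟨y, ⟨y', hy', rfl⟩, x, hx, hxy⟩ := H (n + 1)
      refine ⟨x, hx, ?_⟩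
      cases n with
      | zero => exact Set.mem_univ _
      | succ n =>
        refine ⟨y', ?_, (hxy.trans (sol.map_act h (s.elt 0) y')).symm⟩
        exact (Set.ext_iff.1 (sol.cylinder_tail_cons s (M.lact h (s.elt 0)) n 0) y').2
          (sol.cylinder_succ_subset s n 1 hy'))
  refine ⟨x, hx, hx'.trans ?_⟩
  rw [sol.mk_eq_act s h]
  exact congrArg (fun m => sol.mk (s.tail.cons m) (𝟙 a')) (M.ract_id _).symm

variable {X : A ⥤ Type u}

/-- `meets ξ n C` is the set of elements `x` that unfold in `n` steps as `m₁ ⋯ mₙ ⊗ y` for some word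
`m₁ ⋯ mₙ` whose cylinder in the solution meets `C`. -/
def meets (ξ : X ⟶ (tensorSet M).obj X) :
    ℕ → ∀ {a : A}, Set ((sol M).obj a) → Set (X.obj a)
  | 0, _, C => {_x | C.Nonempty}
  | n + 1, a, C => {x | ∃ (b : A) (m : M.Elt b a) (y : X.obj b), Unfolds ξ x m y ∧
      y ∈ meets ξ n {t | sol.act m t ∈ C}}

variable {ξ : X ⟶ (tensorSet M).obj X}

theorem meets_succ_subset (n : ℕ) {a : A} (C : Set ((sol M).obj a)) :
    meets ξ (n + 1) C ⊆ meets ξ n C := by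
  induction n generalizing a with
  | zero =>
    rintro x ⟨b, m, y, -, t, ht⟩
    exact ⟨_, ht⟩
  | succ n ih =>
    rintro x ⟨b, m, y, h, hy⟩
    exact ⟨b, m, y, h, ih _ hy⟩

theorem Resolution.mem_meets (r : Resolution ξ) {a : A} (f : r.seq.obj 0 ⟶ a)
    {C : Set ((sol M).obj a)} (h : sol.mk r.seq f ∈ C) (n : ℕ) :
    X.map f (r.elt 0) ∈ meets ξ n C := by
  induction n generalizing r a with
  | zero => exact ⟨_, h⟩
  | succ n ih =>
    refine ⟨_, _, _, (r.unfolds 0).map f, ?_⟩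
    have := ih r.tail (𝟙 _) (C := {t | sol.act (M.lact f (r.seq.elt 0)) t ∈ C}) (by
      rw [sol.mk_eq_act] at h
      exact h)
    rwa [X.map_id_apply] at this

/-- Compactness for preimages: if `x` lies in all approximations `meets ξ n C` to the preimage of a
closed set `C`, then it lies in that preimage. The words witnessing this need not be initial segments
of the given resolution `r` of `x`; a branch is sought through stages that consist of a word's
source `w`, the pullback of `C` to `w`, and a span from `w` to `r` carrying an element of `X`. -/
theorem Resolution.mk_mem_of_mem_meets (hM : IsSelfSimilaritySystem M) (hX : ComponentwiseFlat X)
    (r : Resolution ξ) {a : A} (f : r.seq.obj 0 ⟶ a) {C : Set ((sol M).obj a)}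
    (hC : sol.IsLimitClosed C) (h : ∀ n, X.map f (r.elt 0) ∈ meets ξ n C) :
    sol.mk r.seq f ∈ C := by
  obtain ⟨p, hp, H⟩ := exists_path_of_finite
    (S := fun n => Σ w : A, Set ((sol M).obj w) × Σ d : A, (d ⟶ w) × (d ⟶ r.seq.obj n))
    (fun n p q => ∃ (k : M.Elt q.1 p.1) (l : M.Elt q.2.2.1 p.2.2.1),
      q.2.1 = {y | sol.act k y ∈ p.2.1} ∧ M.lact p.2.2.2.1 l = M.ract k q.2.2.2.1 ∧
      M.lact p.2.2.2.2 l = M.ract (r.seq.elt n) q.2.2.2.2)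
    (by
      rintro n ⟨w, D, d, u, g⟩
      have := hM.finite.elt w
      have (e : Σ b : A, M.Elt b w) := hM.finite.over e.2
      have (c : A) := hM.finite.hom (r.seq.elt n) c
      refine (Set.finite_range fun x : (Σ e : (Σ b : A, M.Elt b w), Σ t : (Σ c : A, c ⟶ e.1),
          (t.1 ⟶ r.seq.obj (n + 1))) =>
        (⟨x.1.1, {y | sol.act x.1.2 y ∈ D}, x.2.1.1, x.2.1.2, x.2.2⟩ :
          Σ w : A, Set ((sol M).obj w) × Σ d : A, (d ⟶ w) × (d ⟶ r.seq.obj (n + 1)))).subset ?_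
      rintro ⟨w', D', d', u', g'⟩ ⟨k, l, hD, -, -⟩
      exact ⟨⟨⟨w', k⟩, ⟨d', u'⟩, g'⟩, congrArg (fun E : Set ((sol M).obj w') =>
        (⟨w', E, d', u', g'⟩ : Σ w : A, Set ((sol M).obj w) ×
          Σ d : A, (d ⟶ w) × (d ⟶ r.seq.obj (n + 1)))) hD.symm⟩)
    (fun n k p => ∃ y : X.obj p.2.2.1, X.map p.2.2.2.2 y = r.elt n ∧
      X.map p.2.2.2.1 y ∈ meets ξ k p.2.1)
    (fun n k p ⟨y, hy, hy'⟩ => ⟨y, hy, meets_succ_subset k _ hy'⟩)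
    (by
      rintro n k ⟨w, D, d, u, g⟩ ⟨y, hy, w', m, z, hz, hzk⟩
      obtain ⟨e, l, v, hl⟩ := exists_unfolds ξ y
      obtain ⟨c₁, l₁, u₁, v₁, hv₁, -, hu₁, huv₁⟩ := hz.exists_lift hX hl
      have hr := r.unfolds n
      rw [← hy] at hr
      obtain ⟨c₂, l₂, g₂, v₂, hv₂, hlv₂, hg₂, hgv₂⟩ := hr.exists_lift hX hv₁
      refine ⟨⟨w', {t | sol.act m t ∈ D}, c₂, l₂ ≫ u₁, g₂⟩, ⟨m, _, rfl, ?_, hg₂⟩, v₂, hgv₂, ?_⟩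
      · rw [M.lact_ract, hu₁, M.ract_comp]
      · dsimp only
        rw [X.map_comp_apply, hlv₂, huv₁]
        exact hzk)
    ⟨a, C, r.seq.obj 0, f, 𝟙 _⟩ (fun k => ⟨r.elt 0, by simp, h k⟩)
  choose k l hkC hu hg using fun n => (H n).2
  let w : InfSeq M := ⟨fun n => (p n).1, k⟩
  let d : InfSeq M := ⟨fun n => (p n).2.2.1, l⟩
  let u : Ladder d w := ⟨fun n => (p n).2.2.2.1, fun n => (hu n).symm⟩
  let g : Ladder d r.seq := ⟨fun n => (p n).2.2.2.2, fun n => (hg n).symm⟩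
  have h₀ : ∃ e : (p 0).1 ⟶ a, (p 0).2.2.2.2 ≫ f = (p 0).2.2.2.1 ≫ e ∧
      ∀ y ∈ (p 0).2.1, (sol M).map e y ∈ C := by
    rw [hp]
    exact ⟨𝟙 a, by simp, fun y hy => by simpa using hy⟩
  obtain ⟨e, he, heC⟩ := h₀
  have hw : sol.mk w e ∈ C := hC w e fun n => by
    obtain ⟨y, hy, hy'⟩ := sol.exists_mem_cylinder w (fun n => (p n).2.1)
      (fun j => by
        obtain ⟨y, -, hy⟩ := (H j).1 0
        exact hy)
      (fun j y hy => by
        rw [hkC j] at hy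
        exact hy) n 0
    exact ⟨y, hy, heC y hy'⟩
  have : sol.mk r.seq f = sol.mk w e := by
    rw [← sol.ladder g, ← sol.ladder u]
    exact congrArg (sol.mk d) he
  rwa [this]

theorem toSol_mem_iff (hM : IsSelfSimilaritySystem M) (hX : ComponentwiseFlat X) {a : A}
    {C : Set ((sol M).obj a)} (hC : sol.IsLimitClosed C) (x : X.obj a) :
    (toSol hX ξ).app a x ∈ C ↔ ∀ n, x ∈ meets ξ n C := by
  obtain ⟨r, f, rfl⟩ := exists_resolution ξ x
  rw [toSol_map]
  exact ⟨fun h => r.mem_meets f h, fun h => r.mk_mem_of_mem_meets hM hX f hC h⟩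

end ClosedSets

/-! ### The universal solution in topological spaces -/

section Topological

variable {A : Type u} [SmallCategory A] {M : CatModule A A}

theorem isClosed_tensor_iff {Y : Aᵒᵖ ⥤ Type u} {X : A ⥤ TopCat.{u}}
    {D : Set (Tensor Y (X ⋙ forget TopCat.{u}))} :
    IsClosed D ↔ ∀ (b : A) (y : Y.obj (op b)), IsClosed {x : X.obj b |
      (Tensor.mk y x : Tensor Y (X ⋙ forget TopCat.{u})) ∈ D} := by
  rw [isClosed_coinduced, isClosed_sigma_iff]
  exact ⟨fun h b y => h ⟨b, y⟩, fun h p => h p.1 p.2⟩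

/-- For a nondegenerate functor to spaces, each map `m ⊗ -` is closed: two tensors are equal only
through one of finitely many spans, along which closed sets are pulled back and pushed forward. -/
theorem isClosed_image_mk (hM : M.IsFinite) {X : A ⥤ TopCat.{u}} (hX : NondegenerateTop X)
    {a b : A} (m : M.Elt b a) {D : Set (X.obj b)} (hD : IsClosed D) :
    IsClosed ((fun x : X.obj b => (Tensor.mk (Y := M.flip.obj a) m x :
      Tensor (M.flip.obj a) (X ⋙ forget TopCat.{u}))) '' D) := by
  refine isClosed_tensor_iff.2 fun b' (m' : M.Elt b' a) => ?_
  have := hM.over m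
  have (c : A) := hM.hom m' c
  have eq : {x : X.obj b' | (Tensor.mk (Y := M.flip.obj a) m' x :
      Tensor (M.flip.obj a) (X ⋙ forget TopCat.{u})) ∈ (fun x : X.obj b =>
        (Tensor.mk (Y := M.flip.obj a) m x : Tensor (M.flip.obj a) (X ⋙ forget TopCat.{u}))) '' D} =
      ⋃ p : { p : (Σ t : (Σ c : A, c ⟶ b), (t.1 ⟶ b')) // M.ract m p.1.2 = M.ract m' p.2 },
        X.map p.1.2 '' (X.map p.1.1.2 ⁻¹' D) := by
    ext x
    simp only [Set.mem_ofPred_eq, Set.mem_image, Set.mem_iUnion]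
    constructor
    · rintro ⟨y, hy, h⟩
      obtain ⟨c, g, g', z, hg, rfl, rfl⟩ := hX.1.componentwiseFlat.mk_eq_mk_iff.1 h
      exact ⟨⟨⟨⟨c, g⟩, g'⟩, hg⟩, z, hy, rfl⟩
    · rintro ⟨⟨⟨⟨c, g⟩, g'⟩, hg⟩, z, hz, rfl⟩
      exact ⟨X.map g z, hz, hX.1.componentwiseFlat.mk_eq_mk_iff.2 ⟨c, g, g', z, hg, rfl, rfl⟩⟩
  rw [eq]
  exact isClosed_iUnion_of_finite fun p => hX.2 _ _ (hD.preimage (X.map p.1.1.2).hom.continuous)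

/-- The structure map of a topological coalgebra, on underlying sets. -/
def forgetStr {X : A ⥤ TopCat.{u}} (ξ : X ⟶ (tensorTop M).obj X) :
    X ⋙ forget TopCat.{u} ⟶ (tensorSet M).obj (X ⋙ forget TopCat.{u}) :=
  Functor.whiskerRight ξ (forget TopCat.{u})

theorem forgetStr_comm {X X' : A ⥤ TopCat.{u}} {ξ : X ⟶ (tensorTop M).obj X}
    {ξ' : X' ⟶ (tensorTop M).obj X'} {α : X ⟶ X'} (h : ξ ≫ (tensorTop M).map α = α ≫ ξ') :
    forgetStr ξ ≫ (tensorSet M).map (Functor.whiskerRight α (forget TopCat.{u})) =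
      Functor.whiskerRight α (forget TopCat.{u}) ≫ forgetStr ξ' := by
  exact congrArg (fun k => Functor.whiskerRight k (forget TopCat.{u})) h

theorem isClosed_meets (hM : M.IsFinite) {X : A ⥤ TopCat.{u}} (hX : NondegenerateTop X)
    (ξ : X ⟶ (tensorTop M).obj X) (n : ℕ) {a : A} (C : Set ((sol M).obj a)) :
    IsClosed (X := X.obj a) (meets (forgetStr ξ) n C) := by
  induction n generalizing a with
  | zero => exact isClosed_const
  | succ n ih =>
    have := hM.elt a
    have eq : meets (forgetStr ξ) (n + 1) C = (ξ.app a) ⁻¹' ⋃ p : (Σ b : A, M.Elt b a),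
        (fun x : X.obj p.1 => (Tensor.mk (Y := M.flip.obj a) p.2 x :
          Tensor (M.flip.obj a) (X ⋙ forget TopCat.{u}))) ''
            meets (forgetStr ξ) n {t | sol.act p.2 t ∈ C} := by
      ext x
      simp only [Set.mem_preimage, Set.mem_iUnion]
      constructor
      · rintro ⟨b, m, y, h, hy⟩
        exact ⟨⟨b, m⟩, y, hy, h.symm⟩
      · rintro ⟨⟨b, m⟩, y, hy, h⟩
        exact ⟨b, m, y, h.symm, hy⟩
    rw [eq]
    refine IsClosed.preimage (ξ.app a).hom.continuous ?_
    exact isClosed_iUnion_of_finite fun p => isClosed_image_mk hM hX p.2 (ih _)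

/-- The preimage of a closed set `C` is the intersection of its approximations `meets ξ n C`, which are
closed because the maps `m ⊗ -` are closed and there are finitely many words of each length. -/
theorem continuous_toSol (hM : IsSelfSimilaritySystem M) {X : A ⥤ TopCat.{u}}
    (hX : NondegenerateTop X) (ξ : X ⟶ (tensorTop M).obj X) (a : A) :
    Continuous (X := X.obj a) ((toSol hX.1.componentwiseFlat (forgetStr ξ)).app a) := by
  refine continuous_iff_isClosed.2 fun C hC => ?_
  have eq : (toSol hX.1.componentwiseFlat (forgetStr ξ)).app a ⁻¹' C =
      ⋂ n, meets (forgetStr ξ) n C := by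
    ext x
    rw [Set.mem_iInter]
    exact toSol_mem_iff hM _ (sol.isClosed_iff.1 hC) x
  rw [eq]
  exact isClosed_iInter fun n => isClosed_meets hM.finite hX ξ n C

/-- The solution as a functor to topological spaces. -/
def solTop (M : CatModule A A) : A ⥤ TopCat.{u} where
  obj a := TopCat.of ((sol M).obj a)
  map f := TopCat.ofHom ⟨(sol M).map f, sol.continuous_map f⟩
  map_id a := by
    ext x
    exact (sol M).map_id_apply a x
  map_comp f g := by
    ext x
    exact (sol M).map_comp_apply f g x

theorem continuous_solStr (a : A) :
    Continuous (Y := Tensor (M.flip.obj a) (solTop M ⋙ forget TopCat.{u}))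
      ((solStr M).app a) := by
  refine continuous_iff_isClosed.2 fun D hD => sol.isClosed_iff.2 fun s h H => ?_
  have := sol.isClosed_iff.1 (isClosed_tensor_iff.1 hD (s.obj 1) (M.lact h (s.elt 0)))
    s.tail (𝟙 _)
  have cyl : ∀ n j, sol.cylinder s.tail n j = sol.cylinder s n (j + 1) := by
    intro n
    induction n with
    | zero => exact fun j => rfl
    | succ n ih => exact fun j => congrArg (sol.act (s.elt (j + 1)) '' ·) (ih (j + 1))
  refine this fun n => ?_
  obtain ⟨y, ⟨z, hz, rfl⟩, hy⟩ := H (n + 1)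
  refine ⟨z, by rw [cyl]; exact hz, ?_⟩
  have hu : Unfolds (solStr M) (sol.act (s.elt 0) z) (s.elt 0) z := unfolds_solStr_iff.2 rfl
  have hu' : (Tensor.mk (Y := M.flip.obj a) (M.lact h (s.elt 0)) z :
      Tensor (M.flip.obj a) (sol M)) ∈ D := hu.map h ▸ hy
  have hz' : (sol M).map (𝟙 (s.obj 1)) z = z := (sol M).map_id_apply _ z
  exact (congrArg (fun t => (Tensor.mk (Y := M.flip.obj a) (M.lact h (s.elt 0)) t :
      Tensor (M.flip.obj a) (sol M)) ∈ D) hz').mpr hu'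

/-- The structure map of the solution in topological spaces. -/
def solTopStr (M : CatModule A A) : solTop M ⟶ (tensorTop M).obj (solTop M) where
  app a := TopCat.ofHom ⟨(solStr M).app a, continuous_solStr a⟩
  naturality a a' f := by
    ext x
    exact NatTrans.naturality_apply (solStr M) f x

theorem solTop_nondegenerate (hM : IsSelfSimilaritySystem M) (hS : ConditionS M) :
    NondegenerateTop (solTop M) :=
  ⟨(sol.componentwiseFlat hM hS).nondegenerateSet, fun _ _ f => sol.isClosedMap_map hM hS f⟩

theorem existsUnique_toSolTop (hM : IsSelfSimilaritySystem M) (hS : ConditionS M)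
    {X : A ⥤ TopCat.{u}} (hX : NondegenerateTop X) (ξ : X ⟶ (tensorTop M).obj X) :
    ∃! α : X ⟶ solTop M, ξ ≫ (tensorTop M).map α = α ≫ solTopStr M := by
  have flat := hX.1.componentwiseFlat
  refine ⟨{ app := fun a => TopCat.ofHom ⟨(toSol flat (forgetStr ξ)).app a,
              continuous_toSol hM hX ξ a⟩
            naturality := fun a a' f => ?_ }, ?_, ?_⟩
  · ext x
    exact NatTrans.naturality_apply (toSol flat (forgetStr ξ)) f x
  · ext a x
    exact congrArg (fun k => k.app a x) (toSol_comm flat (forgetStr ξ))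
  · intro α hα
    ext a x
    have := eq_toSol hM hS flat (Functor.whiskerRight α (forget TopCat.{u})) (forgetStr_comm hα)
    exact congrArg (fun k => k.app a x) this

end Topological

/-! ### Terminal coalgebras -/

section Terminal

/-- Terminality among the coalgebras whose carrier satisfies `P`, in terms of structure maps. -/
theorem exists_isTerminal_coalgebra_iff {C : Type*} [Category* C] (F : C ⥤ C) (P : C → Prop) :
    (∃ J : ObjectProperty.FullSubcategory (fun X : Endofunctor.Coalgebra F => P X.V),
      Nonempty (IsTerminal J)) ↔
    ∃ (J : C) (γ : J ⟶ F.obj J), P J ∧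
      ∀ (X : C) (ξ : X ⟶ F.obj X), P X → ∃! α : X ⟶ J, ξ ≫ F.map α = α ≫ γ := by
  constructor
  · rintro ⟨J, ⟨hJ⟩⟩
    refine ⟨J.obj.V, J.obj.str, J.property, fun X ξ hX => ?_⟩
    let X' : ObjectProperty.FullSubcategory (fun X : Endofunctor.Coalgebra F => P X.V) :=
      ⟨⟨X, ξ⟩, hX⟩
    refine ⟨(hJ.from X').hom.f, (hJ.from X').hom.h, fun α hα => ?_⟩
    have := hJ.hom_ext (ObjectProperty.homMk (X := X') (Y := J) ⟨α, hα⟩) (hJ.from X')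
    exact congrArg (fun k => k.hom.f) this
  · rintro ⟨J, γ, hJ, h⟩
    refine ⟨⟨⟨J, γ⟩, hJ⟩, ⟨IsTerminal.ofUniqueHom (fun X => ObjectProperty.homMk
      ⟨(h X.obj.V X.obj.str X.property).choose,
        (h X.obj.V X.obj.str X.property).choose_spec.1⟩) fun X m => ?_⟩⟩
    refine ObjectProperty.hom_ext _ (Endofunctor.Coalgebra.Hom.ext ?_)
    exact (h X.obj.V X.obj.str X.property).choose_spec.2 _ m.hom.h

variable {A : Type u} [SmallCategory A] {M : CatModule A A}

theorem hasUniversalSolutionSet_iff : HasUniversalSolutionSet M ↔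
    ∃ (J : A ⥤ Type u) (γ : J ⟶ (tensorSet M).obj J), NondegenerateSet J ∧
      ∀ (X : A ⥤ Type u) (ξ : X ⟶ (tensorSet M).obj X), NondegenerateSet X →
        ∃! α : X ⟶ J, ξ ≫ (tensorSet M).map α = α ≫ γ :=
  exists_isTerminal_coalgebra_iff _ _

theorem hasUniversalSolutionTop_iff : HasUniversalSolutionTop M ↔
    ∃ (J : A ⥤ TopCat.{u}) (γ : J ⟶ (tensorTop M).obj J), NondegenerateTop J ∧
      ∀ (X : A ⥤ TopCat.{u}) (ξ : X ⟶ (tensorTop M).obj X), NondegenerateTop X →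
        ∃! α : X ⟶ J, ξ ≫ (tensorTop M).map α = α ≫ γ :=
  exists_isTerminal_coalgebra_iff _ _

theorem ConditionS.hasUniversalSolutionTop (hM : IsSelfSimilaritySystem M) (hS : ConditionS M) :
    HasUniversalSolutionTop M :=
  hasUniversalSolutionTop_iff.2 ⟨solTop M, solTopStr M, solTop_nondegenerate hM hS,
    fun _ ξ hX => existsUnique_toSolTop hM hS hX ξ⟩

/-- A set-valued functor with discrete topologies. -/
abbrev discreteTop (X : A ⥤ Type u) : A ⥤ TopCat.{u} := X ⋙ TopCat.discrete

theorem discreteTop_nondegenerate {X : A ⥤ Type u} (hX : NondegenerateSet X) :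
    NondegenerateTop (discreteTop X) := by
  refine ⟨hX, fun a a' f C _ => ?_⟩
  have : DiscreteTopology ((discreteTop X).obj a') := ⟨rfl⟩
  exact isClosed_discrete _

/-- A map out of a functor with discrete topologies. -/
def fromDiscrete {X : A ⥤ Type u} {Y : A ⥤ TopCat.{u}} (α : X ⟶ Y ⋙ forget TopCat.{u}) :
    discreteTop X ⟶ Y where
  app a :=
    letI : TopologicalSpace (X.obj a) := ⊥
    TopCat.ofHom ⟨α.app a, continuous_bot⟩
  naturality a a' f := by
    ext x
    exact NatTrans.naturality_apply α f x

/-- The forgetful functor to sets has the discrete topology functor as a left adjoint, also on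
coalgebras, so it preserves terminal objects. -/
theorem HasUniversalSolutionTop.hasUniversalSolutionSet (h : HasUniversalSolutionTop M) :
    HasUniversalSolutionSet M := by
  obtain ⟨J, γ, hJ, h⟩ := hasUniversalSolutionTop_iff.1 h
  refine hasUniversalSolutionSet_iff.2 ⟨J ⋙ forget TopCat.{u}, forgetStr γ, hJ.1, fun X ξ hX => ?_⟩
  obtain ⟨α, hα, uniq⟩ := h (discreteTop X)
    (fromDiscrete (Y := (tensorTop M).obj (discreteTop X)) ξ) (discreteTop_nondegenerate hX)
  refine ⟨Functor.whiskerRight α (forget TopCat.{u}), forgetStr_comm hα, fun β hβ => ?_⟩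
  have := uniq (fromDiscrete β) (by
    ext a x
    exact congrArg (fun k => k.app a x) hβ)
  rw [← this]
  rfl

/-- The coalgebra generated by a sequence: the sum of the representables `A(aₙ, -)`, in which
the identity of `aₙ` unfolds as `mₙ ⊗ 1`. -/
def seqFunctor (s : InfSeq M) : A ⥤ Type u where
  obj a := Σ n, (s.obj n ⟶ a)
  map h := ↾fun p => ⟨p.1, p.2 ≫ h⟩
  map_id a := by
    ext p
    · rfl
    · simp
  map_comp h h' := by
    ext p
    · rfl
    · simp

/-- The structure map of the coalgebra generated by a sequence. -/
def seqStr (s : InfSeq M) : seqFunctor s ⟶ (tensorSet M).obj (seqFunctor s) where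
  app a := ↾fun p => (Tensor.mk (Y := M.flip.obj a) (M.lact p.2 (s.elt p.1))
    (⟨p.1 + 1, 𝟙 _⟩ : (seqFunctor s).obj _) : Tensor (M.flip.obj a) (seqFunctor s))
  naturality a a' h := by
    refine ConcreteCategory.hom_ext _ _ fun ⟨n, k⟩ => ?_
    exact congrArg (fun m => (Tensor.mk (Y := M.flip.obj a') m
      (⟨n + 1, 𝟙 _⟩ : (seqFunctor s).obj _) : Tensor (M.flip.obj a') (seqFunctor s)))
        (M.lact_comp k h (s.elt n))

theorem seqFunctor_componentwiseFlat (s : InfSeq M) : ComponentwiseFlat (seqFunctor s) where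
  square := by
    rintro a a' b f f' ⟨n, k⟩ ⟨n', k'⟩ h
    obtain ⟨rfl, h⟩ := Sigma.mk.inj_iff.1 h
    exact ⟨s.obj n, k, k', ⟨n, 𝟙 _⟩, eq_of_heq h, congrArg (Sigma.mk n) (Category.id_comp k),
      congrArg (Sigma.mk n) (Category.id_comp k')⟩
  fork := by
    rintro a b f f' ⟨n, k⟩ h
    exact ⟨s.obj n, k, ⟨n, 𝟙 _⟩, eq_of_heq (Sigma.mk.inj_iff.1 h).2,
      congrArg (Sigma.mk n) (Category.id_comp k)⟩

/-- A ladder, acting by precomposition on the generated coalgebras. -/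
def Ladder.seqMap {s t : InfSeq M} (f : Ladder s t) : seqFunctor t ⟶ seqFunctor s where
  app a := ↾fun p => ⟨p.1, f.map p.1 ≫ p.2⟩
  naturality a a' h := by
    refine ConcreteCategory.hom_ext _ _ fun ⟨n, k⟩ => ?_
    exact congrArg (Sigma.mk n) (Category.assoc (f.map n) k h).symm

theorem Ladder.seqMap_comm {s t : InfSeq M} (f : Ladder s t) :
    seqStr t ≫ (tensorSet M).map f.seqMap = f.seqMap ≫ seqStr s := by
  refine NatTrans.ext (funext fun a => ConcreteCategory.hom_ext _ _ fun ⟨n, k⟩ => ?_)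
  change (Tensor.mk (Y := M.flip.obj a) (M.lact k (t.elt n))
      (⟨n + 1, f.map (n + 1) ≫ 𝟙 _⟩ : (seqFunctor s).obj _) :
        Tensor (M.flip.obj a) (seqFunctor s)) =
    Tensor.mk (Y := M.flip.obj a) (M.lact (f.map n ≫ k) (s.elt n))
      (⟨n + 1, 𝟙 _⟩ : (seqFunctor s).obj _)
  rw [M.lact_comp, ← f.comm, M.lact_ract]
  refine Eq.trans ?_ (Tensor.glue (Y := M.flip.obj a) (X := seqFunctor s) (f.map (n + 1))
    (M.lact k (t.elt n)) ⟨n + 1, 𝟙 _⟩).symm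
  exact congrArg (fun h => (Tensor.mk (Y := M.flip.obj a) (M.lact k (t.elt n))
      (⟨n + 1, h⟩ : (seqFunctor s).obj _) : Tensor (M.flip.obj a) (seqFunctor s)))
    ((Category.comp_id _).trans (Category.id_comp _).symm)

/-- A universal solution contains an element `x s` for each sequence `s`, the image of the generator
of the coalgebra that `s` generates, and ladders carry these to one another. Nondegeneracy of the
solution then provides the squares and forks of condition S. -/
theorem HasUniversalSolutionSet.conditionS (h : HasUniversalSolutionSet M) : ConditionS M := by
  obtain ⟨J, γ, hJ, h⟩ := hasUniversalSolutionSet_iff.1 h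
  choose α hα uniq using fun s : InfSeq M =>
    h (seqFunctor s) (seqStr s) (seqFunctor_componentwiseFlat s).nondegenerateSet
  let x : ∀ s : InfSeq M, J.obj (s.obj 0) := fun s => (α s).app _ ⟨0, 𝟙 _⟩
  have hx : ∀ {s t : InfSeq M} (f : Ladder s t), J.map (f.map 0) (x s) = x t := by
    intro s t f
    have e : f.seqMap ≫ α s = α t := uniq t _ (by
      dsimp only
      rw [Functor.map_comp, ← Category.assoc, f.seqMap_comm, Category.assoc, hα s, Category.assoc])
    have e' : (α s).app _ ⟨0, f.map 0 ≫ 𝟙 _⟩ = x t := congrArg (fun k => k.app _ ⟨0, 𝟙 _⟩) e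
    rw [← e']
    refine (NatTrans.naturality_apply (α s) (f.map 0) _).symm.trans ?_
    exact congrArg (fun k => (α s).app _ (⟨0, k⟩ : (seqFunctor s).obj _))
      ((Category.id_comp _).trans (Category.comp_id _).symm)
  have flat := hJ.componentwiseFlat
  constructor
  · intro s s' t f f'
    obtain ⟨c, g, g', -, hg, -, -⟩ := flat.square (f.map 0) (f'.map 0) (x s) (x s')
      ((hx f).trans (hx f').symm)
    exact ⟨c, g, g', hg⟩
  · intro s t f f'
    obtain ⟨c, g, -, hg, -⟩ := flat.fork (f.map 0) (f'.map 0) (x s) ((hx f).trans (hx f').symm)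
    exact ⟨c, g, hg⟩

end Terminal

end SelfSimilarity

theorem theoremA1 {A : Type u} [SmallCategory A] (M : SelfSimilarity.CatModule A A)
    (hM : SelfSimilarity.IsSelfSimilaritySystem M) :
    List.TFAE [SelfSimilarity.ConditionS M,
      SelfSimilarity.HasUniversalSolutionTop M,
      SelfSimilarity.HasUniversalSolutionSet M] := by
  tfae_have 1 → 2 := fun h => h.hasUniversalSolutionTop hM
  tfae_have 2 → 3 := fun h => h.hasUniversalSolutionSet
  tfae_have 3 → 1 := fun h => h.conditionS
  tfae_finish
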